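/- Let $\Delta\subset\mathbb R^n$ be a reflexive lattice polytope of dimension $n$ (each facet $F$ of $\Delta$ lies on a hyperplane $\langle m,v_F\rangle=-1$, where $v_F\in\mathbb Z^n$ is the primitive inward conormal vector of $F$), and let $X$ be the complex projective toric variety determined by $\Delta$, with anticanonical divisor $-K_X=\sum_F D_F$. Let $Y\subset X$ be an anticanonical hypersurface, that is, the zero scheme of a nonzero section of $\mathcal O_X(-K_X)$ (in particular, $Y$ may be a generic member of $|-K_X|$), and let $\mathcal L$ be the restriction to $Y$ of the invertible sheaf $\mathcal O_X(-(n-1)K_X)$. Let $D^b(Y)$ be the bounded derived category of coherent sheaves on $Y$, and for integers $r,s$ let $D^{\le s}\cap D^{\ge r}$ be the class of its objects $\mathcal F$ with $H^j(\mathcal F)=0$ for $j\notin[r,s]$. For $p\in\mathbb Z$ put $\mathcal Ext^p(\mathcal A,\mathcal F)=H^p(R\mathcal Hom(\mathcal A,\mathcal F))$, where $R\mathcal Hom$ is the derived functor of the sheaf $\mathcal Hom$. Let $\mathcal F\in D^b(Y)$ lie in $D^{\le s}\cap D^{\ge r}$ and let $b,p,q\in\mathbb Z$. If $$H^q\big(Y,\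 \mathcal Ext^p(\mathcal L^{\otimes b},\mathcal F)\big)\neq 0,$$ then $(p,q)\in[r,s]\times[0,n-1]$. -/

import Mathlib

open CategoryTheory Limits AlgebraicGeometry TopologicalSpace Opposite

namespace BraneVertex
universe u
noncomputable section

section Injectives

instance presheafOfModules_ab5 {C : Type u} [SmallCategory C] (R : Cᵒᵖ ⥤ RingCat.{u}) :
    AB5OfSize.{u, u} (PresheafOfModules.{u} R) where
  ofShape K _ _ :=
    haveI : PreservesFiniteLimits (PresheafOfModules.toPresheaf.{u} R) := inferInstance
    haveI : ReflectsFiniteLimits (PresheafOfModules.toPresheaf.{u} R) :=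
      ⟨fun _ _ _ => inferInstance⟩
    HasExactColimitsOfShape.domain_of_functor K (PresheafOfModules.toPresheaf.{u} R)

variable (X : Scheme.{u})

theorem modules_ab5 : AB5OfSize.{u, u} (SheafOfModules.{u} X.ringCatSheaf) where
  ofShape K _ _ :=
    haveI := (presheafOfModules_ab5 X.ringCatSheaf.obj).ofShape K
    (PresheafOfModules.sheafificationAdjunction (𝟙 X.ringCatSheaf.obj)).hasExactColimitsOfShape K

theorem modules_hasSeparator : HasSeparator (SheafOfModules.{u} X.ringCatSheaf) := by
  let adj := PresheafOfModules.sheafificationAdjunction (𝟙 X.ringCatSheaf.obj)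
  let G : X.Opens → SheafOfModules.{u} X.ringCatSheaf := fun U =>
    (PresheafOfModules.sheafification (𝟙 X.ringCatSheaf.obj)).obj
      ((PresheafOfModules.free X.ringCatSheaf.obj).obj (yoneda.obj U))
  refine ⟨∐ G, ObjectProperty.IsSeparating.isSeparator_coproduct ?_⟩
  intro M N f g h
  apply (SheafOfModules.forget X.ringCatSheaf ⋙
    PresheafOfModules.restrictScalars (𝟙 X.ringCatSheaf.obj)).map_injective
  refine PresheafOfModules.freeYoneda.isSeparating _ _ _ ?_
  rintro _ ⟨U⟩ k
  have := h (G U) ⟨U⟩ ((adj.homEquiv _ _).symm k)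
  have h2 := congrArg (adj.homEquiv _ _) this
  rw [adj.homEquiv_naturality_right, adj.homEquiv_naturality_right, Equiv.apply_symm_apply] at h2
  exact h2

theorem sheafOfModules_isGrothendieckAbelian :
    IsGrothendieckAbelian.{u} (SheafOfModules.{u} X.ringCatSheaf) :=
  haveI := modules_ab5 X
  haveI := modules_hasSeparator X
  { }

instance modules_isGrothendieckAbelian : IsGrothendieckAbelian.{u} X.Modules :=
  sheafOfModules_isGrothendieckAbelian X

end Injectives

section InternalHom
variable {X : Scheme.{u}} (M N : X.Modules)

/-- The group `Hom(M|_U, N|_U)`: families of `𝒪_X(V)`-linear maps `M(V) → N(V)`, for `V ≤ U`,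
that commute with restriction. -/
def homSections (U : X.Opens) :
    AddSubgroup (∀ V : {V : X.Opens // V ≤ U}, Γ(M, V.1) →ₗ[Γ(X, V.1)] Γ(N, V.1)) where
  carrier := {φ | ∀ (V W : {V : X.Opens // V ≤ U}) (h : W.1 ≤ V.1) (m : Γ(M, V.1)),
    N.presheaf.map (homOfLE h).op (φ V m) = φ W (M.presheaf.map (homOfLE h).op m)}
  zero_mem' := fun V W h m => by simp
  add_mem' := fun {a b} ha hb V W h m => by
    simp only [Pi.add_apply, LinearMap.add_apply, map_add, ha V W h m, hb V W h m]
  neg_mem' := fun {a} ha V W h m => by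
    simp only [Pi.neg_apply, LinearMap.neg_apply, map_neg, ha V W h m]

variable {M N}

/-- Multiplication of a local homomorphism over `U` by a function on `U`. -/
instance homSectionsSMul (U : X.Opens) : SMul Γ(X, U) (homSections M N U) where
  smul r φ := ⟨fun V => X.presheaf.map (homOfLE V.2).op r • φ.1 V, fun V W h m => by
    have : X.presheaf.map (homOfLE h).op (X.presheaf.map (homOfLE V.2).op r) =
        X.presheaf.map (homOfLE W.2).op r := by
      rw [← CategoryTheory.comp_apply, ← Functor.map_comp]; rfl
    simp only [LinearMap.smul_apply]
    rw [Scheme.Modules.map_smul, this, φ.2 V W h m]⟩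

theorem homSections_smul_val {U : X.Opens} (r : Γ(X, U)) (φ : homSections M N U)
    (V : {V : X.Opens // V ≤ U}) :
    (r • φ).1 V = X.presheaf.map (homOfLE V.2).op r • φ.1 V := rfl

instance homSectionsModule (U : X.Opens) : Module Γ(X, U) (homSections M N U) where
  one_smul φ := by
    ext V m
    rw [homSections_smul_val, map_one, one_smul]
  mul_smul r r' φ := by
    ext V m
    rw [homSections_smul_val, homSections_smul_val, homSections_smul_val, map_mul, mul_smul]
  smul_zero r := by
    ext V m
    rw [homSections_smul_val]
    simp
  smul_add r φ ψ := by
    ext V m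
    simp only [homSections_smul_val, AddSubgroup.coe_add, Pi.add_apply, smul_add]
  add_smul r r' φ := by
    ext V m
    simp only [homSections_smul_val, AddSubgroup.coe_add, Pi.add_apply, map_add, add_smul]
  zero_smul φ := by
    ext V m
    rw [homSections_smul_val, map_zero, zero_smul]
    simp

/-- Restriction of local homomorphisms to a smaller open. -/
def homSectionsRes {U U' : X.Opens} (h : U' ≤ U) : homSections M N U →+ homSections M N U' where
  toFun φ := ⟨fun V => φ.1 ⟨V.1, V.2.trans h⟩, fun V W hVW m =>
    φ.2 ⟨V.1, V.2.trans h⟩ ⟨W.1, W.2.trans h⟩ hVW m⟩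
  map_zero' := rfl
  map_add' _ _ := rfl

variable (M N)

/-- The abelian presheaf `U ↦ Hom(M|_U, N|_U)`. -/
def homPresheaf : TopCat.Presheaf Ab.{u} X where
  obj U := AddCommGrpCat.of (homSections M N U.unop)
  map i := AddCommGrpCat.ofHom (homSectionsRes i.unop.le)
  map_id _ := rfl
  map_comp _ _ := rfl

theorem structure_map_map {U V W : X.Opens} (h : W ≤ V) (h' : V ≤ U) (x : Γ(X, U)) :
    X.presheaf.map (homOfLE h).op (X.presheaf.map (homOfLE h').op x) =
      X.presheaf.map (homOfLE (h.trans h')).op x := by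
  rw [← CategoryTheory.comp_apply, ← Functor.map_comp]; rfl

theorem modules_existsUnique_glue (N : X.Modules) {ι : Type u} (U : ι → X.Opens) (V : X.Opens)
    (hU : ∀ i, U i ≤ V) (hV : V ≤ ⨆ i, U i) (s : ∀ i, Γ(N, U i))
    (hs : ∀ i j, N.presheaf.map (homOfLE (inf_le_left : U i ⊓ U j ≤ U i)).op (s i) =
      N.presheaf.map (homOfLE (inf_le_right : U i ⊓ U j ≤ U j)).op (s j)) :
    ∃! t : Γ(N, V), ∀ i, N.presheaf.map (homOfLE (hU i)).op t = s i :=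
  TopCat.Sheaf.existsUnique_gluing' ⟨N.presheaf, N.isSheaf⟩ U V (fun i => homOfLE (hU i)) hV s hs

theorem map_map_apply (N : X.Modules) {U V W : X.Opens} (h : W ≤ V) (h' : V ≤ U) (x : Γ(N, U)) :
    N.presheaf.map (homOfLE h).op (N.presheaf.map (homOfLE h').op x) =
      N.presheaf.map (homOfLE (h.trans h')).op x := by
  rw [← CategoryTheory.comp_apply, ← Functor.map_comp]; rfl

theorem homPresheaf_isSheaf : (homPresheaf M N).IsSheaf := by
  rw [TopCat.Presheaf.isSheaf_iff_isSheafUniqueGluing]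
  intro ι U sf hsf
  have compat : ∀ (i j : ι) (V : X.Opens) (hi : V ≤ U i) (hj : V ≤ U j),
      (sf i).1 ⟨V, hi⟩ = (sf j).1 ⟨V, hj⟩ := by
    intro i j V hi hj
    exact congrFun (congrArg Subtype.val (hsf i j)) ⟨V, le_inf hi hj⟩
  have glue : ∀ (V : X.Opens) (_ : V ≤ iSup U) (m : Γ(M, V)), ∃! t : Γ(N, V), ∀ i,
      N.presheaf.map (homOfLE (inf_le_left : V ⊓ U i ≤ V)).op t =
        (sf i).1 ⟨V ⊓ U i, inf_le_right⟩
          (M.presheaf.map (homOfLE (inf_le_left : V ⊓ U i ≤ V)).op m) := by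
    intro V hV m
    refine modules_existsUnique_glue N (fun i => V ⊓ U i) V (fun i => inf_le_left)
      (by rw [← inf_iSup_eq]; exact le_inf le_rfl hV) _ ?_
    intro i j
    rw [(sf i).2 ⟨V ⊓ U i, inf_le_right⟩ ⟨V ⊓ U i ⊓ (V ⊓ U j), inf_le_left.trans inf_le_right⟩
        inf_le_left,
      (sf j).2 ⟨V ⊓ U j, inf_le_right⟩ ⟨V ⊓ U i ⊓ (V ⊓ U j), inf_le_right.trans inf_le_right⟩
        inf_le_right, map_map_apply, map_map_apply, compat i j]
  have ext_loc : ∀ (V : X.Opens) (_ : V ≤ iSup U) (t t' : Γ(N, V)),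
      (∀ i, N.presheaf.map (homOfLE (inf_le_left : V ⊓ U i ≤ V)).op t =
        N.presheaf.map (homOfLE (inf_le_left : V ⊓ U i ≤ V)).op t') → t = t' := by
    intro V hV t t' h
    refine (modules_existsUnique_glue N (fun i => V ⊓ U i) V (fun i => inf_le_left)
      (by rw [← inf_iSup_eq]; exact le_inf le_rfl hV)
      (fun i => N.presheaf.map (homOfLE (inf_le_left : V ⊓ U i ≤ V)).op t') ?_).unique h
      (fun _ => rfl)
    intro i j
    rw [map_map_apply, map_map_apply]
  choose F hF hF' using glue
  have hFlin : ∀ (V : X.Opens) (hV : V ≤ iSup U), ∃ G : Γ(M, V) →ₗ[Γ(X, V)] Γ(N, V),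
      ∀ m, G m = F V hV m := fun V hV =>
    ⟨{ toFun := F V hV
       map_add' := fun m m' => ext_loc V hV _ _ fun i => by
        rw [map_add, hF V hV _ i, hF V hV _ i, hF V hV _ i, map_add, map_add]
       map_smul' := fun r m => ext_loc V hV _ _ fun i => by
        rw [RingHom.id_apply, Scheme.Modules.map_smul, hF V hV _ i, hF V hV _ i,
          Scheme.Modules.map_smul, map_smul] }, fun _ => rfl⟩
  choose G hG using hFlin
  have hGloc : ∀ i (V : X.Opens) (hV : V ≤ iSup U) (hi : V ≤ U i), G V hV = (sf i).1 ⟨V, hi⟩ := by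
    intro i V hV hi
    ext m
    rw [hG]
    refine ext_loc V hV _ _ fun j => ?_
    rw [hF V hV m j, (sf i).2 ⟨V, hi⟩ ⟨V ⊓ U j, inf_le_left.trans hi⟩ inf_le_left,
      compat i j (V ⊓ U j) (inf_le_left.trans hi) inf_le_right]
  refine ⟨⟨fun V => G V.1 V.2, ?_⟩, ?_, ?_⟩
  · intro V W h m
    refine ext_loc W.1 W.2 _ _ fun i => ?_
    rw [hG, hG, hF W.1 W.2 _ i, map_map_apply, map_map_apply]
    have := congrArg (N.presheaf.map (homOfLE (inf_le_inf_right (U i) h)).op)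
      (hF V.1 V.2 m i)
    rw [map_map_apply, (sf i).2 ⟨V.1 ⊓ U i, inf_le_right⟩ ⟨W.1 ⊓ U i, inf_le_right⟩,
      map_map_apply] at this
    exact this
  · intro i
    apply Subtype.ext
    funext V
    exact hGloc i V.1 (V.2.trans (le_iSup U i)) V.2
  · intro ψ hψ
    apply Subtype.ext
    funext V
    have hψ' : ∀ i (W : X.Opens) (hW : W ≤ iSup U) (hi : W ≤ U i),
        ψ.1 ⟨W, hW⟩ = (sf i).1 ⟨W, hi⟩ := fun i W hW hi =>
      congrFun (congrArg Subtype.val (hψ i)) ⟨W, hi⟩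
    ext m
    refine ext_loc V.1 V.2 _ _ fun i => ?_
    rw [hG, hF V.1 V.2 m i, ψ.2 V ⟨V.1 ⊓ U i, inf_le_left.trans V.2⟩ inf_le_left,
      hψ' i (V.1 ⊓ U i) (inf_le_left.trans V.2) inf_le_right]

instance homPresheafModule (U : (Opens X)ᵒᵖ) :
    Module (X.ringCatSheaf.obj.obj U) ((homPresheaf M N).obj U) :=
  homSectionsModule U.unop

/-- The internal Hom of two `𝒪_X`-modules, as an `𝒪_X`-module. -/
def sheafHomObj : X.Modules :=
  { val := PresheafOfModules.ofPresheaf (R := X.ringCatSheaf.obj) (homPresheaf M N)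
      (by
        intro U V i r φ
        apply Subtype.ext
        funext W
        exact congrArg (fun t : Γ(X, W.1) =>
          t • (show homSections M N U.unop from φ).1 ⟨W.1, W.2.trans i.unop.le⟩)
          (structure_map_map W.2 i.unop.le r).symm)
    isSheaf := homPresheaf_isSheaf M N }

variable {N} {N' : X.Modules}

/-- A morphism of `𝒪_X`-modules on sections over `U`, as an `𝒪_X(U)`-linear map. -/
def appLinear (g : N ⟶ N') (U : X.Opens) : Γ(N, U) →ₗ[Γ(X, U)] Γ(N', U) where
  toFun := g.app U
  map_add' := map_add _
  map_smul' := g.app_smul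

theorem appLinear_res (g : N ⟶ N') {U V : X.Opens} (h : V ≤ U) (x : Γ(N, U)) :
    N'.presheaf.map (homOfLE h).op (appLinear g U x) =
      appLinear g V (N.presheaf.map (homOfLE h).op x) :=
  (ConcreteCategory.congr_hom (g.mapPresheaf.naturality (homOfLE h).op) x).symm

/-- Postcomposition of local homomorphisms with a morphism `g : N ⟶ N'`. -/
def homSectionsPost (g : N ⟶ N') (U : X.Opens) : homSections M N U →+ homSections M N' U where
  toFun φ := ⟨fun V => appLinear g V.1 ∘ₗ φ.1 V, fun V W h m => by
    rw [LinearMap.comp_apply, LinearMap.comp_apply, appLinear_res, φ.2 V W h m]⟩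
  map_zero' := by
    ext V m
    exact map_zero (appLinear g V.1)
  map_add' φ ψ := by
    ext V m
    exact map_add (appLinear g V.1) _ _

/-- The functor `ℋom(M, -)` from `𝒪_X`-modules to `𝒪_X`-modules. -/
def sheafHom : X.Modules ⥤ X.Modules where
  obj N := sheafHomObj M N
  map {N N'} g :=
    { val := PresheafOfModules.homMk (M₁ := (sheafHomObj M N).val) (M₂ := (sheafHomObj M N').val)
        { app := fun U => AddCommGrpCat.ofHom (homSectionsPost M g U.unop)
          naturality := fun _ _ _ => rfl }
        (by
          intro U r φ
          apply Subtype.ext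
          funext V
          ext m
          exact map_smul (appLinear g V.1) _ _) }
  map_id _ := rfl
  map_comp _ _ := rfl

instance sheafHom_additive : (sheafHom M).Additive where
  map_add := rfl

end InternalHom

section Tensor
variable {X : Scheme.{u}}

/-- The tensor product of two `𝒪_X`-modules: the sheaf associated with
`U ↦ M(U) ⊗_{𝒪_X(U)} N(U)`. -/
def tensor (M N : X.Modules) : X.Modules :=
  (PresheafOfModules.sheafification (𝟙 X.ringCatSheaf.obj)).obj
    (PresheafOfModules.Monoidal.tensorObj (R := X.presheaf) M.val N.val)

/-- The structure sheaf as a module over itself. -/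
def structureModule (X : Scheme.{u}) : X.Modules := SheafOfModules.unit X.ringCatSheaf

/-- The tensor power `L^{⊗ k}` for a natural number `k`. -/
def tensorPow (L : X.Modules) : ℕ → X.Modules
  | 0 => structureModule X
  | k + 1 => tensor (tensorPow L k) L

/-- The dual `ℋom(L, 𝒪_X)`. -/
def dual (L : X.Modules) : X.Modules := sheafHomObj L (structureModule X)

/-- The tensor power `L^{⊗ b}` of an invertible sheaf for an integer `b`; negative powers are the
powers of the dual. -/
def tensorZPow (L : X.Modules) : ℤ → X.Modules
  | Int.ofNat k => tensorPow L k
  | Int.negSucc k => tensorPow (dual L) (k + 1)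

end Tensor

section Derived
variable (X : Scheme.{u})

instance modulesHasDerivedCategory : HasDerivedCategory.{u + 1} X.Modules :=
  HasDerivedCategory.standard _

instance abSheavesHasDerivedCategory :
    HasDerivedCategory.{u + 1} (Sheaf (Opens.grothendieckTopology X) AddCommGrpCat.{u}) :=
  HasDerivedCategory.standard _

/-- Coherent sheaves on a (locally Noetherian) scheme: the `𝒪_X`-modules that locally admit a
finite presentation. -/
def IsCoherent {X : Scheme.{u}} (M : X.Modules) : Prop :=
  SheafOfModules.IsFinitePresentation (R := X.ringCatSheaf) M

/-- The objects of the derived category of `𝒪_X`-modules whose cohomology sheaves are coherent and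
vanish outside a bounded range of degrees (objects of `Plus` are bounded below by definition). -/
def isBoundedCoherent : ObjectProperty (DerivedCategory.Plus X.Modules) := fun F =>
  (∃ s : ℤ, F.IsLE s) ∧
    ∀ j : ℤ, IsCoherent ((DerivedCategory.Plus.homologyFunctor X.Modules j).obj F)

/-- The bounded derived category `D^b(X)` of coherent sheaves. -/
abbrev Db := (isBoundedCoherent X).FullSubcategory

variable {X}

/-- The sheaf `ℰxt^p(A, F) = H^p(Rℋom(A, F))`, where `Rℋom(A, -)` is the right derived functor
of the sheaf Hom `ℋom(A, -)`. -/
def extSheaf (p : ℤ) (A : X.Modules) (F : DerivedCategory.Plus X.Modules) : X.Modules :=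
  (DerivedCategory.Plus.homologyFunctor X.Modules p).obj
    ((sheafHom A).rightDerivedFunctorPlus.obj F)

/-- The cohomology group `H^q(X, E)`, `q ∈ ℤ`, of the abelian sheaf underlying an `𝒪_X`-module:
the group `Hom(ℤ_X, E[q])` in the derived category of abelian sheaves on `X`. For `q ≥ 0` this is
`CategoryTheory.Sheaf.H`. -/
def cohomology (q : ℤ) (E : X.Modules) : Type (u + 1) :=
  ShiftedHom
    ((DerivedCategory.singleFunctor _ 0).obj
      ((constantSheaf (Opens.grothendieckTopology X) AddCommGrpCat.{u}).obj
        (AddCommGrpCat.of (ULift.{u} ℤ))))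
    ((DerivedCategory.singleFunctor _ 0).obj ((SheafOfModules.toSheaf X.ringCatSheaf).obj E)) q

instance cohomologyAddCommGroup (q : ℤ) (E : X.Modules) : AddCommGroup (cohomology q E) :=
  inferInstanceAs (AddCommGroup (ShiftedHom _ _ q))

end Derived

section QuotientGrading
variable {A : Type} [CommRing A] [Algebra ℂ A] (𝒜 : ℕ → Submodule ℂ A)

/-- The grading of `A / (f)` induced by a grading of `A`. -/
def quotientGrading (f : A) (k : ℕ) : Submodule ℂ (A ⧸ Ideal.span {f}) :=
  (𝒜 k).map (Ideal.Quotient.mkₐ ℂ (Ideal.span {f})).toLinearMap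

theorem mk_mem_quotientGrading (f : A) {k : ℕ} {a : A} (ha : a ∈ 𝒜 k) :
    Ideal.Quotient.mkₐ ℂ (Ideal.span {f}) a ∈ quotientGrading 𝒜 f k := ⟨a, ha, rfl⟩

/-- The projection `𝒜 k → (A / (f))_k`. -/
def quotientGradingMk (f : A) (k : ℕ) : 𝒜 k →ₗ[ℂ] quotientGrading 𝒜 f k where
  toFun a := ⟨Ideal.Quotient.mkₐ ℂ (Ideal.span {f}) a.1, mk_mem_quotientGrading 𝒜 f a.2⟩
  map_add' _ _ := rfl
  map_smul' _ _ := rfl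

variable [GradedAlgebra 𝒜]

instance quotientGrading_gradedMonoid (f : A) : SetLike.GradedMonoid (quotientGrading 𝒜 f) where
  one_mem := ⟨1, SetLike.GradedOne.one_mem, rfl⟩
  mul_mem := by
    rintro i j _ _ ⟨a, ha, rfl⟩ ⟨b, hb, rfl⟩
    exact ⟨a * b, SetLike.GradedMul.mul_mem ha hb, rfl⟩

/-- Decomposition of the class of an element of `A` into homogeneous components. -/
def quotientDecomposeAux (f : A) : A →ₐ[ℂ] DirectSum ℕ fun k => quotientGrading 𝒜 f k :=
  (DirectSum.toAlgebra ℂ (fun k => 𝒜 k)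
    (fun k => DirectSum.lof ℂ ℕ (fun k => quotientGrading 𝒜 f k) k ∘ₗ quotientGradingMk 𝒜 f k)
    rfl
    (by
      intro i j a b
      exact (DirectSum.of_mul_of (A := fun k => quotientGrading 𝒜 f k)
        (quotientGradingMk 𝒜 f i a) (quotientGradingMk 𝒜 f j b)).symm)).comp
  (DirectSum.decomposeAlgEquiv 𝒜).toAlgHom

theorem quotientDecomposeAux_of_mem (f : A) {k : ℕ} {a : A} (ha : a ∈ 𝒜 k) :
    quotientDecomposeAux 𝒜 f a =
      DirectSum.of (fun k => quotientGrading 𝒜 f k) k ⟨_, mk_mem_quotientGrading 𝒜 f ha⟩ := by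
  unfold quotientDecomposeAux
  rw [AlgHom.comp_apply]
  have h : (DirectSum.decomposeAlgEquiv 𝒜).toAlgHom a = DirectSum.of (fun k => 𝒜 k) k ⟨a, ha⟩ :=
    DirectSum.decompose_of_mem 𝒜 ha
  rw [h]
  exact DirectSum.toAddMonoid_of _ _ _

/-- The quotient of a graded algebra by a homogeneous element is graded. -/
instance quotientGradedAlgebra {d : ℕ} (f : 𝒜 d) : GradedAlgebra (quotientGrading 𝒜 (f : A)) :=
  GradedAlgebra.ofAlgHom _
    (Ideal.Quotient.liftₐ (Ideal.span {(f : A)}) (quotientDecomposeAux 𝒜 f) (by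
      have h0 : quotientDecomposeAux 𝒜 f (f : A) = 0 := by
        rw [quotientDecomposeAux_of_mem 𝒜 f f.2]
        refine (congrArg _ (Subtype.ext ?_)).trans (map_zero _)
        exact Ideal.Quotient.eq_zero_iff_mem.2 (Ideal.mem_span_singleton_self (f : A))
      intro a ha
      obtain ⟨c, rfl⟩ := Ideal.mem_span_singleton'.1 ha
      rw [map_mul, h0, mul_zero]))
    (by
      apply Ideal.Quotient.algHom_ext
      apply AlgHom.ext
      intro a
      induction a using DirectSum.Decomposition.inductionOn 𝒜 with
      | zero => simp
      | add a b ha hb => rw [map_add, ha, hb, map_add]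
      | @homogeneous i a =>
        change DirectSum.coeAlgHom _ (quotientDecomposeAux 𝒜 f a.1) = _
        rw [quotientDecomposeAux_of_mem 𝒜 f a.2, DirectSum.coeAlgHom_of]
        rfl)
    (by
      rintro i ⟨_, a, ha, rfl⟩
      exact quotientDecomposeAux_of_mem 𝒜 f ha)

/-- The projection `A → A / (f)` as a graded ring homomorphism. -/
def quotientGradedHom (f : A) : GradedRingHom 𝒜 (quotientGrading 𝒜 f) where
  __ := Ideal.Quotient.mk (Ideal.span {f})
  map_mem ha := mk_mem_quotientGrading 𝒜 f ha

theorem irrelevant_le_map_quotient {d : ℕ} (f : 𝒜 d) :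
    HomogeneousIdeal.irrelevant (quotientGrading 𝒜 (f : A)) ≤
      (HomogeneousIdeal.irrelevant 𝒜).map (quotientGradedHom 𝒜 (f : A)) := by
  refine (HomogeneousIdeal.irrelevant_le _).2 ?_
  rintro i hi _ ⟨a, ha, rfl⟩
  exact Ideal.mem_map_of_mem _ (HomogeneousIdeal.mem_irrelevant_of_mem 𝒜 hi ha)

/-- The closed subscheme `V(f)` of `Proj 𝒜` cut out by a homogeneous element `f`, that is
`Proj (A / (f))`. -/
def projZeroLocus {d : ℕ} (f : 𝒜 d) : Scheme.{0} := Proj (quotientGrading 𝒜 (f : A))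

/-- The inclusion `V(f) ⟶ Proj 𝒜`. -/
def projZeroLocusι {d : ℕ} (f : 𝒜 d) : projZeroLocus 𝒜 f ⟶ Proj 𝒜 :=
  Proj.map (quotientGradedHom 𝒜 (f : A)) (irrelevant_le_map_quotient 𝒜 f)

end QuotientGrading

section Twist
variable {A : Type} [CommRing A] [Algebra ℂ A] (𝒜 : ℕ → Submodule ℂ A) [GradedAlgebra 𝒜]

/-- The localization `A_𝔭` of `A` at a point `𝔭` of `Proj 𝒜`; it contains the stalk
`𝒪(k)_𝔭` as its part of degree `k`. -/
abbrev LocAt (x : ProjectiveSpectrum 𝒜) : Type :=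
  Localization.AtPrime x.asHomogeneousIdeal.toIdeal

/-- The functions `s` on an open set `U` of `Proj 𝒜` with values `s(𝔭) ∈ A_𝔭` that are locally
of the form `a / b` with `a`, `b` homogeneous and `deg a = deg b + k`. -/
def isTwistSection (k : ℤ) :
    TopCat.LocalPredicate (X := ProjectiveSpectrum.top 𝒜) (fun x => LocAt 𝒜 x) where
  pred {U} s := ∀ x : U, ∃ V : Opens (ProjectiveSpectrum.top 𝒜), x.1 ∈ V ∧
    ∃ (i j : ℕ) (a : 𝒜 i) (b : 𝒜 j), (i : ℤ) = j + k ∧ ∀ y : U, y.1 ∈ V →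
      (b : A) ∉ ProjectiveSpectrum.asHomogeneousIdeal (𝒜 := 𝒜) y.1 ∧
      algebraMap A (LocAt 𝒜 y.1) b * s y = algebraMap A (LocAt 𝒜 y.1) a
  res {V U} i s hs x := by
    obtain ⟨W, hxW, i', j', a, b, hij, h⟩ := hs ⟨x.1, i.le x.2⟩
    exact ⟨W, hxW, i', j', a, b, hij, fun y hy => h ⟨y.1, i.le y.2⟩ hy⟩
  locality {U} s hs x := by
    obtain ⟨V, hxV, i, hV⟩ := hs x
    obtain ⟨W, hxW, i', j', a, b, hij, h⟩ := hV ⟨x.1, hxV⟩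
    exact ⟨V ⊓ W, ⟨hxV, hxW⟩, i', j', a, b, hij, fun y hy => h ⟨y.1, hy.1⟩ hy.2⟩

theorem exists_homogeneous_notMem (x : ProjectiveSpectrum 𝒜) :
    ∃ (d : ℕ) (b : 𝒜 d), 0 < d ∧ (b : A) ∉ x.asHomogeneousIdeal := by
  by_contra! h
  exact x.not_irrelevant_le
    ((HomogeneousIdeal.irrelevant_le 𝒜).2 fun i hi b hb => h i ⟨b, hb⟩ hi)

/-- Sections of `𝒪(k)` over `U`. -/
def twistSections (k : ℤ) (U : Opens (ProjectiveSpectrum.top 𝒜)) :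
    AddSubgroup (∀ x : U, LocAt 𝒜 x.1) where
  carrier := {s | (isTwistSection 𝒜 k).pred s}
  zero_mem' := fun x => by
    obtain ⟨d, b, hd, hb⟩ := exists_homogeneous_notMem 𝒜 x.1
    have hle : k.natAbs ≤ k.natAbs * d := Nat.le_mul_of_pos_right _ hd
    refine ⟨ProjectiveSpectrum.basicOpen 𝒜 b, hb, (k.natAbs * d + k).toNat, k.natAbs • d,
      0, ⟨b ^ k.natAbs, SetLike.pow_mem_graded _ b.2⟩, ?_, fun y hy => ⟨?_, ?_⟩⟩
    · rw [smul_eq_mul, Int.toNat_of_nonneg (by zify at hle; simp only [Int.natCast_natAbs] at *; have := neg_abs_le k; omega)]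
      push_cast
      rfl
    · exact fun h => hy ((ProjectiveSpectrum.isPrime y.1).mem_of_pow_mem _ h)
    · simp
  add_mem' := fun {s t} hs ht x => by
    obtain ⟨V, hxV, i, j, a, b, hij, h⟩ := hs x
    obtain ⟨W, hxW, i', j', a', b', hij', h'⟩ := ht x
    refine ⟨V ⊓ W, ⟨hxV, hxW⟩, j + i', j + j', ⟨b' * a + b * a', ?_⟩,
      ⟨b * b', SetLike.mul_mem_graded b.2 b'.2⟩, by push_cast; omega, ?_⟩
    · refine add_mem ?_ (SetLike.mul_mem_graded b.2 a'.2)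
      have : j' + i = j + i' := by omega
      exact this ▸ SetLike.mul_mem_graded b'.2 a.2
    · intro y hy
      obtain ⟨h1, h2⟩ := h y hy.1
      obtain ⟨h1', h2'⟩ := h' y hy.2
      refine ⟨fun hmem =>
        ((ProjectiveSpectrum.isPrime y.1).mem_or_mem hmem).elim h1 h1', ?_⟩
      simp only [Pi.add_apply, map_add, map_mul, ← h2, ← h2']
      ring
  neg_mem' := fun {s} hs x => by
    obtain ⟨V, hxV, i, j, a, b, hij, h⟩ := hs x
    refine ⟨V, hxV, i, j, -a, b, hij, fun y hy => ⟨(h y hy).1, ?_⟩⟩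
    rw [Pi.neg_apply, mul_neg, (h y hy).2]
    simp

variable {𝒜}

/-- The value in `A_𝔭` of a function on an open subset of `Proj 𝒜` at a point `𝔭`. -/
def sectionValue {U : (Proj 𝒜).Opens} (x : U) : Γ(Proj 𝒜, U) →+* LocAt 𝒜 x.1 where
  toFun r := ((show (ProjectiveSpectrum.Proj.structureSheaf 𝒜).1.obj (op U) from r).1 x).val
  map_one' := HomogeneousLocalization.val_one
  map_mul' _ _ := HomogeneousLocalization.val_mul _ _
  map_zero' := HomogeneousLocalization.val_zero
  map_add' _ _ := HomogeneousLocalization.val_add _ _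

theorem sectionValue_locally {U : (Proj 𝒜).Opens} (r : Γ(Proj 𝒜, U)) (x : U) :
    ∃ V : Opens (ProjectiveSpectrum.top 𝒜), x.1 ∈ V ∧ ∃ (l : ℕ) (c e : 𝒜 l), ∀ y : U, y.1 ∈ V →
      (e : A) ∉ ProjectiveSpectrum.asHomogeneousIdeal (𝒜 := 𝒜) y.1 ∧
      algebraMap A (LocAt 𝒜 y.1) e * sectionValue y r = algebraMap A (LocAt 𝒜 y.1) c := by
  obtain ⟨V, hxV, iV, ⟨l, c, e, he, hce⟩⟩ :=
    (show (ProjectiveSpectrum.Proj.structureSheaf 𝒜).1.obj (op U) from r).2 x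
  refine ⟨V, hxV, l, c, e, fun y hy => ⟨he ⟨y.1, hy⟩, ?_⟩⟩
  have := congrArg HomogeneousLocalization.val (hce ⟨y.1, hy⟩)
  rw [HomogeneousLocalization.val_mk] at this
  refine (congrArg _ this).trans ?_
  rw [Localization.mk_eq_mk', mul_comm]
  exact IsLocalization.mk'_spec (LocAt 𝒜 y.1) (c : A) ⟨(e : A), he ⟨y.1, hy⟩⟩

/-- Functions act on sections of `𝒪(k)` by pointwise multiplication. -/
instance twistSectionsSMul (k : ℤ) (U : (Proj 𝒜).Opens) :
    SMul Γ(Proj 𝒜, U) (twistSections 𝒜 k U) where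
  smul r s := ⟨fun x => sectionValue x r * s.1 x, fun x => by
    obtain ⟨V, hxV, l, c, e, hV⟩ := sectionValue_locally r x
    obtain ⟨W, hxW, i, j, a, b, hij, hW⟩ := s.2 x
    refine ⟨V ⊓ W, ⟨hxV, hxW⟩, l + i, l + j, ⟨c * a, SetLike.mul_mem_graded c.2 a.2⟩,
      ⟨e * b, SetLike.mul_mem_graded e.2 b.2⟩, by push_cast; omega, fun y hy => ?_⟩
    obtain ⟨h1, h2⟩ := hW y hy.2
    obtain ⟨h3, h4⟩ := hV y hy.1
    refine ⟨fun hmem => ((ProjectiveSpectrum.isPrime y.1).mem_or_mem hmem).elim h3 h1, ?_⟩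
    simp only [map_mul, ← h2, ← h4]
    ring⟩

instance twistSectionsModule (k : ℤ) (U : (Proj 𝒜).Opens) :
    Module Γ(Proj 𝒜, U) (twistSections 𝒜 k U) where
  one_smul s := Subtype.ext (funext fun x =>
    (congrArg (· * s.1 x) (map_one (sectionValue x))).trans (one_mul _))
  mul_smul r r' s := Subtype.ext (funext fun x =>
    (congrArg (· * s.1 x) (map_mul (sectionValue x) r r')).trans (mul_assoc _ _ _))
  smul_zero _ := Subtype.ext (funext fun _ => mul_zero _)
  smul_add _ _ _ := Subtype.ext (funext fun _ => mul_add _ _ _)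
  add_smul r r' s := Subtype.ext (funext fun x =>
    (congrArg (· * s.1 x) (map_add (sectionValue x) r r')).trans (add_mul _ _ _))
  zero_smul s := Subtype.ext (funext fun x =>
    (congrArg (· * s.1 x) (map_zero (sectionValue x))).trans (zero_mul _))

variable (𝒜)

/-- The abelian presheaf of sections of `𝒪(k)`. -/
def twistPresheaf (k : ℤ) : TopCat.Presheaf Ab.{0} (Proj 𝒜) where
  obj U := AddCommGrpCat.of (twistSections 𝒜 k U.unop)
  map i := AddCommGrpCat.ofHom
    { toFun := fun s => ⟨fun x => s.1 ⟨x.1, i.unop.le x.2⟩, (isTwistSection 𝒜 k).res i.unop s.1 s.2⟩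
      map_zero' := rfl
      map_add' := fun _ _ => rfl }
  map_id _ := rfl
  map_comp _ _ := rfl

theorem twistPresheaf_isSheaf (k : ℤ) : (twistPresheaf 𝒜 k).IsSheaf := by
  rw [TopCat.Presheaf.isSheaf_iff_isSheaf_comp (forget Ab)]
  exact TopCat.subpresheafToTypes.isSheaf (isTwistSection 𝒜 k)

instance twistPresheafModule (k : ℤ) (U : (Opens (Proj 𝒜))ᵒᵖ) :
    Module ((Proj 𝒜).ringCatSheaf.obj.obj U) ((twistPresheaf 𝒜 k).obj U) :=
  twistSectionsModule k U.unop

/-- The twisting sheaf `𝒪(k)` on `Proj 𝒜`. -/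
def twist (k : ℤ) : (Proj 𝒜).Modules :=
  { val := PresheafOfModules.ofPresheaf (R := (Proj 𝒜).ringCatSheaf.obj) (twistPresheaf 𝒜 k)
      (fun _ _ _ _ _ => rfl)
    isSheaf := twistPresheaf_isSheaf 𝒜 k }

end Twist

section Toric
open Pointwise

/-- A lattice point as a point of `ℝ^n`. -/
def toReal {n : ℕ} (m : Fin n → ℤ) : Fin n → ℝ := fun i => (m i : ℝ)

/-- A lattice polytope of dimension `n` in `ℝ^n`, given by a finite set of lattice points of which
it is the convex hull. -/
structure LatticePolytope (n : ℕ) where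
  /-- lattice points whose convex hull is the polytope -/
  points : Finset (Fin n → ℤ)
  /-- the polytope has dimension `n` -/
  fullDim : affineSpan ℝ (toReal '' (points : Set (Fin n → ℤ))) = ⊤

namespace LatticePolytope
variable {n : ℕ} (Δ : LatticePolytope n)

/-- The underlying convex set. -/
def carrier : Set (Fin n → ℝ) := convexHull ℝ (toReal '' (Δ.points : Set (Fin n → ℤ)))

/-- The set of points of `Δ` on the hyperplane `⟨m, v⟩ = -c`. -/
def slice (v : Fin n → ℤ) (c : ℤ) : Set (Fin n → ℝ) :=
  {m ∈ Δ.carrier | m ⬝ᵥ toReal v = -(c : ℝ)}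

/-- `v` is the primitive inward conormal of a facet of `Δ` that lies on the hyperplane
`⟨m, v⟩ = -c`. -/
structure IsFacetNormal (v : Fin n → ℤ) (c : ℤ) : Prop where
  primitive : ∀ d : ℤ, (∀ i, d ∣ v i) → IsUnit d
  inward : ∀ m ∈ Δ.carrier, -(c : ℝ) ≤ m ⬝ᵥ toReal v
  nonempty : (Δ.slice v c).Nonempty
  codim_one : Module.finrank ℝ (vectorSpan ℝ (Δ.slice v c)) + 1 = n

/-- `Δ` is reflexive: all facets lie on hyperplanes `⟨m, v_F⟩ = -1`, with `v_F` the primitive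
inward conormal. -/
def IsReflexive : Prop := ∀ v c, Δ.IsFacetNormal v c → c = 1

theorem carrier_nonempty : Δ.carrier.Nonempty := by
  rw [carrier, convexHull_nonempty_iff]
  by_contra h
  rw [Set.not_nonempty_iff_eq_empty] at h
  have h1 := Δ.fullDim
  rw [h, AffineSubspace.span_empty] at h1
  exact AffineSubspace.bot_ne_top _ _ _ h1

/-- The monoid of lattice points `(m, k)` with `m ∈ k Δ`, of the cone over `Δ × {1}`. -/
def coneMonoid : AddSubmonoid ((Fin n → ℤ) × ℕ) where
  carrier := {x | toReal x.1 ∈ (x.2 : ℝ) • Δ.carrier}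
  zero_mem' := by
    rw [Set.mem_ofPred_eq, Prod.snd_zero, Nat.cast_zero, Set.zero_smul_set Δ.carrier_nonempty]
    ext i
    simp [toReal]
  add_mem' := by
    intro x y hx hy
    have hconv : Convex ℝ Δ.carrier := convex_convexHull ℝ _
    have hadd : toReal (x + y).1 = toReal x.1 + toReal y.1 := by
      ext i
      simp [toReal]
    rw [Set.mem_ofPred_eq, hadd, Prod.snd_add, Nat.cast_add,
      hconv.add_smul (Nat.cast_nonneg _) (Nat.cast_nonneg _)]
    exact Set.add_mem_add hx hy

/-- The polytope algebra `S_Δ`: the semigroup algebra over `ℂ` with basis `χ^m t^k`, `m ∈ k Δ`. -/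
abbrev polytopeAlgebra : Type := AddMonoidAlgebra ℂ Δ.coneMonoid

/-- The degree `χ^m t^k ↦ k`. -/
def degree : Δ.coneMonoid →+ ℕ := (AddMonoidHom.snd (Fin n → ℤ) ℕ).comp Δ.coneMonoid.subtype

/-- The grading of `S_Δ` by degree. -/
def grading (k : ℕ) : Submodule ℂ Δ.polytopeAlgebra := AddMonoidAlgebra.gradeBy ℂ Δ.degree k

instance gradingGradedAlgebra : GradedAlgebra Δ.grading :=
  AddMonoidAlgebra.gradeBy.gradedAlgebra Δ.degree

/-- The projective toric variety `X = Proj S_Δ` of the polytope `Δ` (equivalently, of its inner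
normal fan), polarized by the divisor `D_Δ = ∑_F c_F D_F`. -/
def toricVariety : Scheme.{0} := Proj Δ.grading

/-- The sheaf `𝒪_X(k D_Δ)`, which is the twisting sheaf `𝒪(k)` of `Proj S_Δ`. If `Δ` is reflexive
then all `c_F = 1`, so `D_Δ = ∑_F D_F = -K_X` and this is `𝒪_X(-k K_X)`. -/
def anticanonicalSheaf (k : ℤ) : Δ.toricVariety.Modules := twist Δ.grading k

/-- The member of the linear system `|D_Δ|` (which is `|-K_X|` for reflexive `Δ`) defined by
a section `f` of `𝒪_X(D_Δ)`. The space of sections is the degree one part of `S_Δ`; its basis is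
formed by the characters `χ^m`, `m ∈ Δ ∩ ℤ^n`. -/
def hypersurface (f : Δ.grading 1) : Scheme.{0} := projZeroLocus Δ.grading f

/-- The inclusion of the hypersurface `Y` in `X`. -/
def hypersurfaceι (f : Δ.grading 1) : Δ.hypersurface f ⟶ Δ.toricVariety :=
  projZeroLocusι Δ.grading f

/-- The restriction `ℒ` to `Y` of the sheaf `𝒪_X(-(n-1) K_X)`. -/
def lineBundle (f : Δ.grading 1) : (Δ.hypersurface f).Modules :=
  (Scheme.Modules.pullback (Δ.hypersurfaceι f)).obj (Δ.anticanonicalSheaf ((n : ℤ) - 1))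

end LatticePolytope
end Toric
end

end BraneVertex

/-!
If `A` is an invertible sheaf then `ℋom(A, -)` is exact, so `ℰxt^p(A, F)` is `ℋom(A, H^p(F))`. This
vanishes for `p ∉ [r, s]`, which bounds `p`, and it is locally isomorphic to the quasi-coherent
sheaf `H^p(F)`. Cohomology of a sheaf vanishes in negative degrees; to see that it vanishes in
degrees `≥ n`, we cover `Y` by at most `n` affine open sets on which `A` is trivial and use
Mayer–Vietoris together with the vanishing of higher cohomology on affine schemes.

The open sets are the loci `g_i ≠ 0` of sections `g_i` of `𝒪_X(1)`. The homogeneous coordinate ring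
of `X` is a domain of transcendence degree at most `n + 1`, so any `n + 1` of its elements satisfy
an algebraic relation modulo `f`. For elements of degree one the relation may be taken homogeneous,
so that projecting linearly from a point outside its zeros gets rid of one of them.
-/


namespace BraneVertex
universe w u
noncomputable section

/-! ### Cohomology of abelian sheaves -/

section FreeSheaf
variable {T : Type u} [TopologicalSpace T]

/-- Abelian sheaves on a topological space. -/
abbrev AbSheaf (T : Type u) [TopologicalSpace T] : Type (u + 1) :=
  Sheaf (Opens.grothendieckTopology T) AddCommGrpCat.{u}

/-- The free abelian sheaf `ℤ_U` generated by an open set `U`; it represents `F ↦ Γ(U, F)`. -/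
abbrev freeSheaf (T : Type u) [TopologicalSpace T] : Opens T ⥤ AbSheaf T :=
  yoneda ⋙ (Functor.whiskeringRight _ _ _).obj AddCommGrpCat.free ⋙ presheafToSheaf _ _

/-- Morphisms `ℤ_U ⟶ F` are sections of `F` over `U`. -/
def freeSheafHomEquiv (U : Opens T) (F : AbSheaf T) :
    ((freeSheaf T).obj U ⟶ F) ≃ F.obj.obj (op U) :=
  ((sheafificationAdjunction _ _).homEquiv _ _).trans
    (((AddCommGrpCat.adj.whiskerRight (Opens T)ᵒᵖ).homEquiv (yoneda.obj U) F.obj).trans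
      yonedaEquiv)

theorem freeSheafHomEquiv_comp {U : Opens T} {F G : AbSheaf T} (φ : (freeSheaf T).obj U ⟶ F)
    (g : F ⟶ G) :
    freeSheafHomEquiv U G (φ ≫ g) = g.hom.app (op U) (freeSheafHomEquiv U F φ) := by
  dsimp only [freeSheafHomEquiv, Equiv.trans_apply]
  erw [Adjunction.homEquiv_naturality_right, Adjunction.homEquiv_naturality_right]
  rfl

theorem freeSheafHomEquiv_sub {U : Opens T} {F : AbSheaf T} (φ ψ : (freeSheaf T).obj U ⟶ F) :
    freeSheafHomEquiv U F (φ - ψ) = freeSheafHomEquiv U F φ - freeSheafHomEquiv U F ψ := by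
  have eq_app (χ : (freeSheaf T).obj U ⟶ F) : freeSheafHomEquiv U F χ =
      χ.hom.app (op U) (freeSheafHomEquiv U _ (𝟙 _)) := by
    rw [← freeSheafHomEquiv_comp, Category.id_comp]
  rw [eq_app φ, eq_app ψ, eq_app (φ - ψ)]
  rfl

theorem freeSheafHomEquiv_map_comp {U V : Opens T} (i : V ⟶ U) {F : AbSheaf T}
    (φ : (freeSheaf T).obj U ⟶ F) :
    freeSheafHomEquiv V F ((freeSheaf T).map i ≫ φ) =
      F.obj.map i.op (freeSheafHomEquiv U F φ) := by
  let sheafify := sheafificationAdjunction (Opens.grothendieckTopology T) AddCommGrpCat.{u}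
  let free := AddCommGrpCat.adj.{u}.whiskerRight (Opens T)ᵒᵖ
  have natural_sheafify := sheafify.homEquiv_naturality_left
    (((Functor.whiskeringRight _ _ _).obj AddCommGrpCat.free).map (yoneda.map i)) φ
  have natural_free := free.homEquiv_naturality_left (yoneda.map i) (sheafify.homEquiv _ _ φ)
  exact (congrArg (fun t => yonedaEquiv (free.homEquiv (yoneda.obj V) F.obj t))
    natural_sheafify).trans
      ((congrArg yonedaEquiv natural_free).trans (yonedaEquiv_naturality _ i).symm)

theorem exists_local_lift {F G : AbSheaf T} (g : F ⟶ G) [Epi g] {U : Opens T}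
    (φ : (freeSheaf T).obj U ⟶ G) {x : T} (hx : x ∈ U) :
    ∃ (V : Opens T) (h : V ≤ U) (ψ : (freeSheaf T).obj V ⟶ F), x ∈ V ∧
      ψ ≫ g = (freeSheaf T).map (homOfLE h) ≫ φ := by
  have hg := (TopCat.Sheaf.isLocallySurjective_iff_epi (X := TopCat.of T) g).2 ‹Epi g›
  obtain ⟨V, h, ⟨t, ht⟩, hxV⟩ :=
    (TopCat.Presheaf.isLocallySurjective_iff (X := TopCat.of T) g.hom).1 hg U
      (freeSheafHomEquiv U G φ) x hx
  refine ⟨V, h, (freeSheafHomEquiv V F).symm t, hxV, (freeSheafHomEquiv V G).injective ?_⟩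
  rw [freeSheafHomEquiv_comp, Equiv.apply_symm_apply, freeSheafHomEquiv_map_comp, ht]
  rfl

theorem isZero_freeSheaf_bot : IsZero ((freeSheaf T).obj ⊥) := by
  refine (IsZero.iff_id_eq_zero _).2 ((freeSheafHomEquiv ⊥ _).injective ?_)
  have h := (TopCat.Sheaf.isTerminalOfEmpty (X := TopCat.of T) ((freeSheaf T).obj ⊥)).isZero
  exact (AddCommGrpCat.subsingleton_of_isZero h).elim _ _

/-- The constant sheaf `ℤ` is the free abelian sheaf generated by the whole space. -/
def constantSheafIsoFreeSheaf :
    (constantSheaf (Opens.grothendieckTopology T) AddCommGrpCat.{u}).obj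
      (AddCommGrpCat.of (ULift.{u} ℤ)) ≅ (freeSheaf T).obj ⊤ :=
  (presheafToSheaf _ _).mapIso (NatIso.ofComponents (fun U =>
    haveI : Unique ((yoneda.obj (⊤ : Opens T)).obj U) := ⟨⟨homOfLE le_top⟩, fun _ => rfl⟩
    (AddEquiv.ulift.trans
      (FreeAbelianGroup.uniqueEquiv ((yoneda.obj (⊤ : Opens T)).obj U)).symm).toAddCommGrpIso)
    (by
      intro U V i
      apply ConcreteCategory.hom_ext
      intro x
      change x.down • FreeAbelianGroup.of (homOfLE le_top) =
        FreeAbelianGroup.map ((yoneda.obj (⊤ : Opens T)).map i)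
          (x.down • FreeAbelianGroup.of (homOfLE le_top))
      rw [map_zsmul, FreeAbelianGroup.map_of_apply]
      rfl))

end FreeSheaf

section Ext
variable {C : Type*} [Category* C] [Abelian C] [HasExt.{w} C]
open Abelian

theorem ext_eq_zero_of_isZero {A B : C} (hA : IsZero A) {q : ℕ} (x : Ext A B q) : x = 0 := by
  rw [← Ext.mk₀_id_comp x, (IsZero.iff_id_eq_zero _).1 hA, Ext.mk₀_zero, Ext.zero_comp]

theorem ext_subsingleton_of_iso {A A' B : C} (e : A ≅ A') {q : ℕ}
    (h : Subsingleton (Ext A' B q)) : Subsingleton (Ext A B q) := by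
  refine subsingleton_of_forall_eq 0 fun x => ?_
  rw [← Ext.mk₀_id_comp x, ← e.hom_inv_id, ← Ext.mk₀_comp_mk₀_assoc,
    h.elim ((Ext.mk₀ e.inv).comp x (zero_add q)) 0, Ext.comp_zero]

theorem exists_shortExact_comp_extClass_surjective [EnoughInjectives C] (B : C) :
    ∃ (I Q : C) (f : B ⟶ I) (g : I ⟶ Q) (w : f ≫ g = 0)
      (hS : (ShortComplex.mk f g w).ShortExact), ∀ (A : C) (q : ℕ) (α : Ext A B (q + 1)),
        ∃ β : Ext A Q q, β.comp hS.extClass rfl = α := by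
  have hS : (ShortComplex.mk (Injective.ι B) (cokernel.π _) (cokernel.condition _)).ShortExact :=
    { exact := ShortComplex.exact_cokernel (Injective.ι B)
      mono_f := inferInstanceAs (Mono (Injective.ι B))
      epi_g := inferInstanceAs (Epi (cokernel.π (Injective.ι B))) }
  exact ⟨_, _, _, _, _, hS, fun A q α => Ext.covariant_sequence_exact₁ _ hS α
    (Ext.eq_zero_of_injective (I := Injective.under B) _) rfl⟩

end Ext

section Cohomology
variable {T : Type u} [TopologicalSpace T] [HasExt.{w} (AbSheaf T)]
open Abelian

/-- Restriction of cohomology classes of an abelian sheaf to a smaller open set. -/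
def cohomologyRes (F : AbSheaf T) (q : ℕ) {U V : Opens T} (h : V ≤ U) : F.H' q U →+ F.H' q V :=
  ((F.cohomologyPresheaf q).map (homOfLE h).op).hom

theorem cohomologyRes_apply (F : AbSheaf T) {q : ℕ} {U V : Opens T} (h : V ≤ U)
    (α : Ext ((freeSheaf T).obj U) F q) :
    cohomologyRes F q h α =
      (Ext.mk₀ ((freeSheaf T).map (homOfLE h))).comp α (zero_add q) := rfl

theorem cohomologyRes_cohomologyRes (F : AbSheaf T) {q : ℕ} {U V W : Opens T} (h : W ≤ V)
    (h' : V ≤ U) (α : F.H' q U) :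
    cohomologyRes F q h (cohomologyRes F q h' α) = cohomologyRes F q (h.trans h') α := by
  dsimp only [cohomologyRes]
  rw [← CategoryTheory.comp_apply, ← Functor.map_comp]
  rfl

theorem cohomologyRes_self (F : AbSheaf T) {q : ℕ} {U : Opens T} (α : F.H' q U) :
    cohomologyRes F q le_rfl α = α :=
  ConcreteCategory.congr_hom ((F.cohomologyPresheaf q).map_id _) α

theorem cohomologyRes_eq_zero_of_le {F : AbSheaf T} {q : ℕ} {U V W : Opens T} (h : W ≤ V)
    (h' : V ≤ U) {α : F.H' q U} (hα : cohomologyRes F q h' α = 0) :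
    cohomologyRes F q (h.trans h') α = 0 := by
  rw [← cohomologyRes_cohomologyRes F h h', hα, map_zero]

theorem exists_cohomologyRes_eq_zero (F : AbSheaf T) (q : ℕ) {U : Opens T} (α : F.H' (q + 1) U)
    {x : T} (hx : x ∈ U) :
    ∃ (V : Opens T) (h : V ≤ U), x ∈ V ∧ cohomologyRes F (q + 1) h α = 0 := by
  induction q generalizing F with
  | zero =>
    obtain ⟨I, Q, f, g, w, hS, surj⟩ := exists_shortExact_comp_extClass_surjective.{w} F
    obtain ⟨β, rfl⟩ := surj ((freeSheaf T).obj U) 0 α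
    obtain ⟨φ, rfl⟩ := (Ext.mk₀_bijective _ _).2 β
    have : Epi g := hS.epi_g
    obtain ⟨V, h, ψ, hxV, hψ⟩ := exists_local_lift g φ hx
    refine ⟨V, h, hxV, (cohomologyRes_apply F h _).trans ?_⟩
    rw [Ext.mk₀_comp_mk₀_assoc, ← hψ, ← Ext.mk₀_comp_mk₀_assoc, hS.comp_extClass, Ext.comp_zero]
    rfl
  | succ q ih =>
    obtain ⟨I, Q, f, g, w, hS, surj⟩ := exists_shortExact_comp_extClass_surjective.{w} F
    obtain ⟨β, rfl⟩ := surj ((freeSheaf T).obj U) (q + 1) α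
    obtain ⟨V, h, hxV, hV⟩ := ih Q β
    replace hV : (Ext.mk₀ ((freeSheaf T).map (homOfLE h))).comp β (zero_add _) = 0 := hV
    refine ⟨V, h, hxV, (cohomologyRes_apply F h _).trans ?_⟩
    rw [← Ext.comp_assoc _ _ _ (zero_add _) rfl (by omega), hV, Ext.zero_comp]
    rfl

theorem eq_zero_of_cohomologyRes_eq_zero (F : AbSheaf T) {q : ℕ} {U V W : Opens T} (hU : U ≤ W)
    (hV : V ≤ W) (hW : W = U ⊔ V) {α : F.H' (q + 1) W}
    (hαU : cohomologyRes F (q + 1) hU α = 0) (hαV : cohomologyRes F (q + 1) hV α = 0)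
    (h : ∀ β : F.H' q (U ⊓ V), ∃ (γ : F.H' q U) (γ' : F.H' q V),
      β = cohomologyRes F q inf_le_left γ - cohomologyRes F q inf_le_right γ') : α = 0 := by
  subst hW
  let S := Opens.mayerVietorisSquare U V
  obtain ⟨β, rfl⟩ : ∃ β, S.δ F q (q + 1) rfl β = α := by
    refine (ShortComplex.ab_exact_iff _).1 ((S.sequence_exact F q (q + 1) rfl).exact 2) α ?_
    have res_eq_zero : (cohomologyRes F (q + 1) hU α, cohomologyRes F (q + 1) hV α) = 0 :=
      Prod.ext hαU hαV
    exact (S.toBiprod_apply F α).trans ((congrArg _ res_eq_zero).trans (map_zero _))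
  obtain ⟨γ, γ', rfl⟩ := h β
  have eq_fromBiprod := S.fromBiprod_biprodIsoProd_inv_apply F (n := q) γ γ'
  exact (congrArg _ eq_fromBiprod.symm).trans (ConcreteCategory.congr_hom
    (S.fromBiprod_δ F q (q + 1) rfl) ((AddCommGrpCat.biprodIsoProd _ _).inv ⟨γ, γ'⟩))

theorem eq_zero_of_cohomologyRes_eq_zero_of_sections (F : AbSheaf T) {U V W : Opens T}
    (hU : U ≤ W) (hV : V ≤ W) (hW : W = U ⊔ V) {α : F.H' 1 W}
    (hαU : cohomologyRes F 1 hU α = 0) (hαV : cohomologyRes F 1 hV α = 0)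
    (h : ∀ t : F.obj.obj (op (U ⊓ V)), ∃ (s : F.obj.obj (op U)) (s' : F.obj.obj (op V)),
      t = F.obj.map (homOfLE inf_le_left).op s - F.obj.map (homOfLE inf_le_right).op s') :
    α = 0 := by
  refine eq_zero_of_cohomologyRes_eq_zero F hU hV hW hαU hαV fun β => ?_
  obtain ⟨φ, rfl⟩ := (Ext.mk₀_bijective _ _).2 β
  obtain ⟨s, s', hs⟩ := h (freeSheafHomEquiv _ F φ)
  obtain ⟨ψ, rfl⟩ := (freeSheafHomEquiv _ F).surjective s
  obtain ⟨ψ', rfl⟩ := (freeSheafHomEquiv _ F).surjective s'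
  refine ⟨Ext.mk₀ ψ, Ext.mk₀ ψ', ?_⟩
  have hφ : φ = (freeSheaf T).map (homOfLE (inf_le_left : U ⊓ V ≤ U)) ≫ ψ -
      (freeSheaf T).map (homOfLE (inf_le_right : U ⊓ V ≤ V)) ≫ ψ' := by
    apply (freeSheafHomEquiv _ F).injective
    rw [freeSheafHomEquiv_sub, freeSheafHomEquiv_map_comp, freeSheafHomEquiv_map_comp, hs]
  rw [cohomologyRes_apply, cohomologyRes_apply, Ext.mk₀_comp_mk₀, Ext.mk₀_comp_mk₀, hφ]
  exact map_sub Ext.addEquiv₀.symm _ _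

theorem subsingleton_H'_bot (F : AbSheaf T) (q : ℕ) : Subsingleton (F.H' q (⊥ : Opens T)) :=
  subsingleton_of_forall_eq 0 fun α =>
    ext_eq_zero_of_isZero (A := (freeSheaf T).obj ⊥) (B := F) isZero_freeSheaf_bot α

theorem subsingleton_H'_sup {F : AbSheaf T} {P : Opens T → Prop}
    (hP : ∀ U V, P U → P V → P (U ⊓ V))
    (hF : ∀ U, P U → ∀ q : ℕ, Subsingleton (F.H' (q + 1) U)) {ι : Type*} (s : Finset ι)
    (U : ι → Opens T) (hU : ∀ i ∈ s, P (U i)) {q : ℕ} (hq : s.card ≤ q) :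
    Subsingleton (F.H' q (s.sup U)) := by
  classical
  induction s using Finset.induction_on generalizing U q with
  | empty => exact subsingleton_H'_bot F q
  | insert i s hi ih =>
    rw [Finset.card_insert_of_notMem hi] at hq
    rw [Finset.forall_mem_insert] at hU
    obtain ⟨q, rfl⟩ := Nat.exists_eq_add_of_le' (Nat.le_of_add_left_le hq)
    have inf_vanishing : Subsingleton (F.H' q (U i ⊓ s.sup U)) := by
      rw [Finset.sup_inf_distrib_left]
      exact ih _ (fun j hj => hP _ _ hU.1 (hU.2 j hj)) (by omega)
    refine subsingleton_of_forall_eq 0 fun α => ?_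
    exact eq_zero_of_cohomologyRes_eq_zero F (U := U i) (V := s.sup U)
      (Finset.sup_insert.ge.trans' le_sup_left) (Finset.sup_insert.ge.trans' le_sup_right)
      Finset.sup_insert ((hF _ hU.1 q).elim _ _) ((ih U hU.2 (by omega)).elim _ _)
      fun _ => ⟨0, 0, inf_vanishing.elim _ _⟩

theorem subsingleton_H_of_H' (F : AbSheaf T) {q : ℕ} (h : Subsingleton (F.H' q (⊤ : Opens T))) :
    Subsingleton (F.H q) :=
  ext_subsingleton_of_iso (A' := (freeSheaf T).obj ⊤) (B := F) constantSheafIsoFreeSheaf h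

end Cohomology

/-! ### Vanishing of higher cohomology on affine open sets -/

section AffineVanishing
variable {X : Scheme.{u}}

/-- The underlying abelian sheaf of a sheaf of modules. -/
abbrev abSheaf (E : X.Modules) : AbSheaf X := (SheafOfModules.toSheaf X.ringCatSheaf).obj E

theorem map_smul_homOfLE (E : X.Modules) {U V : X.Opens} (h : V ≤ U) (r : Γ(X, U)) (m : Γ(E, U)) :
    E.presheaf.map (homOfLE h).op (r • m) =
      X.presheaf.map (homOfLE h).op r • E.presheaf.map (homOfLE h).op m :=
  Scheme.Modules.map_smul E (homOfLE h) r m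

theorem map_self_apply (E : X.Modules) {U : X.Opens} (m : Γ(E, U)) :
    E.presheaf.map (homOfLE le_rfl).op m = m :=
  ConcreteCategory.congr_hom (E.presheaf.map_id _) m

theorem isUnit_map_of_le_basicOpen {U V : X.Opens} (hV : V ≤ U) {c : Γ(X, U)}
    (hc : V ≤ X.basicOpen c) : IsUnit (X.presheaf.map (homOfLE hV).op c) := by
  rw [← structure_map_map hc (X.basicOpen_le c)]
  exact (X.toRingedSpace.isUnit_res_basicOpen c).map (X.presheaf.map (homOfLE hc).op).hom

/-- Every section of `E` over a principal open set `D(f) ⊆ U` extends to `U` after multiplication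
by a power of `f`. This is the part of quasi-coherence that the vanishing of cohomology uses. -/
def ExtendsFromBasicOpens (E : X.Modules) (U : X.Opens) : Prop :=
  ∀ (f : Γ(X, U)) (t : Γ(E, X.basicOpen f)), ∃ (N : ℕ) (m : Γ(E, U)),
    E.presheaf.map (homOfLE (X.basicOpen_le f)).op m =
      X.presheaf.map (homOfLE (X.basicOpen_le f)).op (f ^ N) • t

theorem ExtendsFromBasicOpens.exists_map_eq {E : X.Modules} {U V : X.Opens}
    (hE : ExtendsFromBasicOpens E U) {f : Γ(X, U)} (hV : V = X.basicOpen f) (t : Γ(E, V)) :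
    ∃ (N : ℕ) (m : Γ(E, U)), E.presheaf.map (homOfLE (hV.trans_le (X.basicOpen_le f))).op m =
      X.presheaf.map (homOfLE (hV.trans_le (X.basicOpen_le f))).op (f ^ N) • t := by
  subst hV
  exact hE f t

theorem map_appIso_inv_fromSpec {U : X.Opens} (hU : IsAffineOpen U) (W : (Spec Γ(X, U)).Opens)
    (hW : hU.fromSpec ''ᵁ W ≤ U) (r : Γ(X, U)) :
    (hU.fromSpec.appIso W).inv ((Spec Γ(X, U)).presheaf.map W.leTop.op
      ((Scheme.ΓSpecIso Γ(X, U)).inv r)) = X.presheaf.map (homOfLE hW).op r := by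
  have : (Scheme.ΓSpecIso Γ(X, U)).inv ≫ (Spec Γ(X, U)).presheaf.map W.leTop.op ≫
      (hU.fromSpec.appIso W).inv = X.presheaf.map (homOfLE hW).op := by
    rw [← Category.assoc, Iso.comp_inv_eq, Scheme.Hom.appIso_hom', Scheme.Hom.map_appLE,
      Scheme.Hom.appLE, hU.fromSpec_app_self, Category.assoc, ← Functor.map_comp]
    rfl
  exact ConcreteCategory.congr_hom this r

theorem extendsFromBasicOpens_of_isQuasicoherent (E : X.Modules) [E.IsQuasicoherent]
    {U : X.Opens} (hU : IsAffineOpen U) : ExtendsFromBasicOpens E U := by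
  intro f t
  have localizing :=
    (isIso_fromTildeΓ_iff_isLocalizing (E.restrict hU.fromSpec)).1 inferInstance f
  have image_basicOpen : hU.fromSpec ''ᵁ PrimeSpectrum.basicOpen f = X.basicOpen f :=
    hU.fromSpec_image_basicOpen f
  have image_top : hU.fromSpec ''ᵁ ⊤ = U := by
    rw [Scheme.Hom.image_top_eq_opensRange, hU.opensRange_fromSpec]
  have hle : hU.fromSpec ''ᵁ PrimeSpectrum.basicOpen f ≤ U :=
    image_basicOpen.le.trans (X.basicOpen_le f)
  obtain ⟨⟨m, ⟨_, N, rfl⟩⟩, hm⟩ := localizing.surj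
    (show Γ(E, hU.fromSpec ''ᵁ PrimeSpectrum.basicOpen f) from
      E.presheaf.map (homOfLE image_basicOpen.le).op t)
  replace hm : X.presheaf.map (homOfLE hle).op (f ^ N) •
      E.presheaf.map (homOfLE image_basicOpen.le).op t =
        E.presheaf.map (homOfLE (Scheme.Hom.image_mono _ le_top)).op
          (show Γ(E, hU.fromSpec ''ᵁ ⊤) from m) := by
    rw [← map_appIso_inv_fromSpec hU _ hle]
    exact hm
  refine ⟨N, E.presheaf.map (homOfLE image_top.ge).op m, ?_⟩
  have hm' := congrArg (E.presheaf.map (homOfLE image_basicOpen.ge).op) hm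
  rw [map_smul_homOfLE, map_map_apply, map_map_apply, structure_map_map, map_self_apply] at hm'
  exact (map_map_apply E _ _ _).trans hm'.symm

theorem exists_map_pow_smul_eq {E : X.Modules} {U V : X.Opens} (hV : V ≤ U) {c : Γ(X, U)}
    (hc : V ≤ X.basicOpen c) (N : ℕ) (m : Γ(E, V)) :
    ∃ s : Γ(E, V), X.presheaf.map (homOfLE hV).op (c ^ N) • s = m := by
  rw [map_pow]
  obtain ⟨u, hu⟩ := (isUnit_map_of_le_basicOpen hV hc).pow N
  exact ⟨(↑u⁻¹ : Γ(X, V)) • m, by rw [smul_smul, ← hu, Units.mul_inv, one_smul]⟩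

theorem ExtendsFromBasicOpens.exists_eq_sub_of_isCoprime {E : X.Modules} {U : X.Opens}
    (hE : ExtendsFromBasicOpens E U) {f g : Γ(X, U)} (hfg : IsCoprime f g)
    (t : Γ(E, X.basicOpen f ⊓ X.basicOpen g)) :
    ∃ (s : Γ(E, X.basicOpen f)) (s' : Γ(E, X.basicOpen g)),
      t = E.presheaf.map (homOfLE inf_le_left).op s -
        E.presheaf.map (homOfLE inf_le_right).op s' := by
  have inf_eq : X.basicOpen f ⊓ X.basicOpen g = X.basicOpen (f * g) := (X.basicOpen_mul f g).symm
  obtain ⟨N, m, hm⟩ := hE.exists_map_eq inf_eq t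
  obtain ⟨a, b, hab⟩ : IsCoprime (f ^ N) (g ^ N) := hfg.pow
  -- `t = m / (f g) ^ N` and `a f ^ N + b g ^ N = 1`, so `t = b m / f ^ N - (- a m / g ^ N)`.
  obtain ⟨s, hs⟩ := exists_map_pow_smul_eq (X.basicOpen_le f) le_rfl N
    (E.presheaf.map (homOfLE (X.basicOpen_le f)).op (b • m))
  obtain ⟨s', hs'⟩ := exists_map_pow_smul_eq (X.basicOpen_le g) le_rfl N
    (E.presheaf.map (homOfLE (X.basicOpen_le g)).op (-a • m))
  refine ⟨s, s', ?_⟩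
  have hle : X.basicOpen f ⊓ X.basicOpen g ≤ U := inf_le_left.trans (X.basicOpen_le f)
  replace hs := congrArg (E.presheaf.map
    (homOfLE (inf_le_left : X.basicOpen f ⊓ X.basicOpen g ≤ _)).op) hs
  replace hs' := congrArg (E.presheaf.map
    (homOfLE (inf_le_right : X.basicOpen f ⊓ X.basicOpen g ≤ _)).op) hs'
  rw [map_smul_homOfLE, structure_map_map, map_map_apply, map_smul_homOfLE] at hs hs'
  have isUnit_pow : IsUnit (X.presheaf.map (homOfLE hle).op ((f * g) ^ N)) := by
    rw [map_pow]
    exact (isUnit_map_of_le_basicOpen hle inf_eq.le).pow N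
  refine isUnit_pow.smul_left_cancel.1 (hm.symm.trans ?_)
  rw [mul_pow, map_mul, smul_sub, mul_smul, mul_smul, smul_comm, hs, hs', smul_smul, smul_smul,
    ← sub_smul, ← map_mul, ← map_mul, ← map_sub]
  rw [show g ^ N * b - f ^ N * -a = 1 by rw [← hab]; ring, map_one, one_smul]

theorem basicOpen_sup_basicOpen_of_isCoprime {U : X.Opens} {f g : Γ(X, U)}
    (hfg : IsCoprime f g) : X.basicOpen f ⊔ X.basicOpen g = U := by
  have span_eq_top : Ideal.span {f, g} = ⊤ := by
    rw [Ideal.span_insert, Ideal.sup_eq_top_iff_isCoprime]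
    exact hfg
  exact iSup_pair.symm.trans (iSup_basicOpen_of_span_eq_top U {f, g} span_eq_top)

theorem isCoprime_map_of_le_basicOpen_add {U V : X.Opens} (hV : V ≤ U) {f g : Γ(X, U)}
    (h : V ≤ X.basicOpen (f + g)) :
    IsCoprime (X.presheaf.map (homOfLE hV).op f) (X.presheaf.map (homOfLE hV).op g) := by
  obtain ⟨u, hu⟩ := isUnit_map_of_le_basicOpen hV h
  exact ⟨↑u⁻¹, ↑u⁻¹, by rw [← mul_add, ← map_add, ← hu, Units.inv_mul]⟩

variable [HasExt.{w} (AbSheaf X)]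

theorem ExtendsFromBasicOpens.eq_zero_of_isCoprime {E : X.Modules} {U : X.Opens}
    (hE : ExtendsFromBasicOpens E U) {f g : Γ(X, U)} (hfg : IsCoprime f g) {q : ℕ}
    (hq : ∀ p < q, Subsingleton ((abSheaf E).H' (p + 1) (X.basicOpen f ⊓ X.basicOpen g)))
    {α : (abSheaf E).H' (q + 1) U}
    (hf : cohomologyRes (abSheaf E) (q + 1) (X.basicOpen_le f) α = 0)
    (hg : cohomologyRes (abSheaf E) (q + 1) (X.basicOpen_le g) α = 0) : α = 0 := by
  have hU := (basicOpen_sup_basicOpen_of_isCoprime hfg).symm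
  cases q with
  | zero =>
    exact eq_zero_of_cohomologyRes_eq_zero_of_sections (abSheaf E) _ _ hU hf hg
      (hE.exists_eq_sub_of_isCoprime hfg)
  | succ q =>
    exact eq_zero_of_cohomologyRes_eq_zero (abSheaf E) _ _ hU hf hg
      fun _ => ⟨0, 0, (hq q q.lt_succ_self).elim _ _⟩

theorem cohomologyRes_basicOpen_add_eq_zero {E : X.Modules} {U : X.Opens} {f g : Γ(X, U)}
    (hE : ExtendsFromBasicOpens E (X.basicOpen (f + g))) {q : ℕ}
    (hq : ∀ p < q, Subsingleton
      ((abSheaf E).H' (p + 1) (X.basicOpen (f + g) ⊓ (X.basicOpen f ⊓ X.basicOpen g))))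
    {α : (abSheaf E).H' (q + 1) U}
    (hf : cohomologyRes (abSheaf E) (q + 1) (X.basicOpen_le f) α = 0)
    (hg : cohomologyRes (abSheaf E) (q + 1) (X.basicOpen_le g) α = 0) :
    cohomologyRes (abSheaf E) (q + 1) (X.basicOpen_le (f + g)) α = 0 := by
  have hle := X.basicOpen_le (f + g)
  have res_eq (c : Γ(X, U)) : X.basicOpen (X.presheaf.map (homOfLE hle).op c) =
      X.basicOpen (f + g) ⊓ X.basicOpen c := X.basicOpen_res c _
  refine hE.eq_zero_of_isCoprime (isCoprime_map_of_le_basicOpen_add hle le_rfl) ?_ ?_ ?_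
  · simpa only [res_eq, ← inf_inf_distrib_left] using hq
  · rw [cohomologyRes_cohomologyRes]
    exact cohomologyRes_eq_zero_of_le ((res_eq f).trans_le inf_le_right) _ hf
  · rw [cohomologyRes_cohomologyRes]
    exact cohomologyRes_eq_zero_of_le ((res_eq g).trans_le inf_le_right) _ hg

theorem subsingleton_H'_of_isAffineOpen {E : X.Modules} {U : X.Opens} (hU : IsAffineOpen U)
    (hE : ∀ V ≤ U, IsAffineOpen V → ExtendsFromBasicOpens E V) (q : ℕ) :
    Subsingleton ((abSheaf E).H' (q + 1) U) := by
  induction q using Nat.strong_induction_on generalizing U with | _ q ih => ?_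
  refine subsingleton_of_forall_eq 0 fun α => ?_
  let I : Ideal Γ(X, U) :=
    { carrier := {f | cohomologyRes (abSheaf E) (q + 1) (X.basicOpen_le f) α = 0}
      zero_mem' := by
        have h := subsingleton_H'_bot (abSheaf E) (q + 1)
        rw [← X.basicOpen_zero U] at h
        exact h.elim _ _
      smul_mem' := fun a f hf => cohomologyRes_eq_zero_of_le
        ((X.basicOpen_mul a f).trans_le inf_le_right) (X.basicOpen_le f) hf
      add_mem' := fun {f g} hf hg => by
        refine cohomologyRes_basicOpen_add_eq_zero
          (hE _ (X.basicOpen_le _) (hU.basicOpen _)) (fun p hp => ?_) hf hg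
        rw [← X.basicOpen_mul, ← X.basicOpen_mul]
        exact ih p hp (hU.basicOpen _) fun V hV => hE V (hV.trans (X.basicOpen_le _)) }
  have span_eq_top : Ideal.span (I : Set Γ(X, U)) = ⊤ := by
    refine hU.self_le_iSup_basicOpen_iff.1 fun x hx => ?_
    obtain ⟨V, hVU, hxV, hV⟩ := exists_cohomologyRes_eq_zero (abSheaf E) q α hx
    obtain ⟨f, hfV, hxf⟩ := hU.exists_basicOpen_le ⟨x, hxV⟩ hx
    exact Opens.mem_iSup.2 ⟨⟨f, cohomologyRes_eq_zero_of_le hfV hVU hV⟩, hxf⟩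
  rw [Ideal.span_eq, Ideal.eq_top_iff_one] at span_eq_top
  rw [← cohomologyRes_self (abSheaf E) α]
  exact cohomologyRes_eq_zero_of_le X.basicOpen_one.ge _ span_eq_top

theorem subsingleton_cohomology_of_H' (E : X.Modules) {q : ℕ}
    (h : Subsingleton ((abSheaf E).H' q (⊤ : X.Opens))) :
    Subsingleton (cohomology (q : ℤ) E) := by
  have := subsingleton_H_of_H' _ h
  exact (Abelian.Ext.homEquiv
    (X := (constantSheaf (Opens.grothendieckTopology X) AddCommGrpCat.{u}).obj
      (AddCommGrpCat.of (ULift.{u} ℤ)))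
    (Y := abSheaf E) (n := q)).symm.subsingleton

end AffineVanishing

/-! ### Locally free sheaves of rank one -/

section Basis
variable {X : Scheme.{u}} {M : X.Modules} (N : X.Modules)

/-- The section `e` is a basis of the `𝒪_U`-module `M|_U`. -/
def IsBasisOn (M : X.Modules) (U : X.Opens) (e : Γ(M, U)) : Prop :=
  ∀ (V : X.Opens) (h : V ≤ U),
    Function.Bijective fun r : Γ(X, V) => r • M.presheaf.map (homOfLE h).op e

/-- The restriction `M|_U` is free of rank one. -/
def IsFreeOn (M : X.Modules) (U : X.Opens) : Prop := ∃ e, IsBasisOn M U e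

/-- Invertible sheaves, as locally free sheaves of rank one. -/
def IsInvertible (M : X.Modules) : Prop := ∀ x : X, ∃ U : X.Opens, x ∈ U ∧ IsFreeOn M U

theorem IsBasisOn.restrict {U : X.Opens} {e : Γ(M, U)} (he : IsBasisOn M U e) {V : X.Opens}
    (h : V ≤ U) : IsBasisOn M V (M.presheaf.map (homOfLE h).op e) := by
  intro W hW
  simp only [map_map_apply]
  exact he W (hW.trans h)

theorem IsFreeOn.mono {U V : X.Opens} (hM : IsFreeOn M U) (h : V ≤ U) : IsFreeOn M V :=
  hM.elim fun _ he => ⟨_, he.restrict h⟩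

theorem eq_of_locally_eq {U : X.Opens} {s t : Γ(N, U)}
    (h : ∀ x ∈ U, ∃ (V : X.Opens) (hV : V ≤ U), x ∈ V ∧
      N.presheaf.map (homOfLE hV).op s = N.presheaf.map (homOfLE hV).op t) : s = t := by
  choose V hV hxV hst using fun x : U => h x.1 x.2
  refine (modules_existsUnique_glue N V U hV
    (fun x hx => Opens.mem_iSup.2 ⟨⟨x, hx⟩, hxV ⟨x, hx⟩⟩)
    (fun x => N.presheaf.map (homOfLE (hV x)).op t) fun x y => ?_).unique hst fun _ => rfl
  rw [map_map_apply, map_map_apply]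

theorem isBasisOn_of_locally {U : X.Opens} {e : Γ(M, U)}
    (inj : ∀ (V : X.Opens) (h : V ≤ U) (r : Γ(X, V)),
      r • M.presheaf.map (homOfLE h).op e = 0 → r = 0)
    (surj : ∀ (V : X.Opens) (_ : V ≤ U) (m : Γ(M, V)), ∀ x ∈ V,
      ∃ (W : X.Opens) (hW : W ≤ V) (hWU : W ≤ U) (r : Γ(X, W)), x ∈ W ∧
        r • M.presheaf.map (homOfLE hWU).op e = M.presheaf.map (homOfLE hW).op m) :
    IsBasisOn M U e := by
  have injective (V : X.Opens) (h : V ≤ U) : Function.Injective fun r : Γ(X, V) =>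
      r • M.presheaf.map (homOfLE h).op e := by
    intro r r' hr
    refine sub_eq_zero.1 (inj V h _ ?_)
    rw [sub_smul]
    exact sub_eq_zero.2 hr
  intro V hV
  refine ⟨injective V hV, fun m => ?_⟩
  choose W hWV hWU r hx hr using fun x : V => surj V hV m x.1 x.2
  have res_eq (x : V) (W' : X.Opens) (h : W' ≤ W x) : X.presheaf.map (homOfLE h).op (r x) •
      M.presheaf.map (homOfLE (h.trans (hWU x))).op e =
        M.presheaf.map (homOfLE (h.trans (hWV x))).op m := by
    rw [← map_map_apply M h (hWU x), ← map_map_apply M h (hWV x), ← map_smul_homOfLE, hr]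
  obtain ⟨t, ht, -⟩ := modules_existsUnique_glue (structureModule X) W V hWV
    (fun x hxV => Opens.mem_iSup.2 ⟨⟨x, hxV⟩, hx ⟨x, hxV⟩⟩) r
    fun x y => injective (W x ⊓ W y) (inf_le_left.trans (hWU x))
      ((res_eq x _ inf_le_left).trans (res_eq y _ inf_le_right).symm)
  refine ⟨t, eq_of_locally_eq M fun x hxV => ⟨_, hWV ⟨x, hxV⟩, hx ⟨x, hxV⟩, ?_⟩⟩
  refine (map_smul_homOfLE M (hWV ⟨x, hxV⟩) (show Γ(X, V) from t) _).trans ?_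
  rw [map_map_apply, ← hr]
  exact congrArg (· • _) (ht ⟨x, hxV⟩)

/-- The section `1` of the structure sheaf. -/
def oneSection (U : X.Opens) : Γ(structureModule X, U) := (1 : Γ(X, U))

theorem smul_map_oneSection {U V : X.Opens} (h : V ≤ U) (r : Γ(X, V)) :
    r • (structureModule X).presheaf.map (homOfLE h).op (oneSection U) = r :=
  (congrArg (r * ·) (map_one (X.presheaf.map (homOfLE h).op).hom)).trans (mul_one r)

theorem isBasisOn_oneSection (U : X.Opens) : IsBasisOn (structureModule X) U (oneSection U) := by
  intro V h
  simp only [smul_map_oneSection]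
  exact Function.bijective_id

/-- The coordinate isomorphism `r ↦ r • e` given by a basis `e`. -/
def IsBasisOn.coord {U : X.Opens} {e : Γ(M, U)} (he : IsBasisOn M U e) :
    Γ(X, U) ≃ₗ[Γ(X, U)] Γ(M, U) :=
  LinearEquiv.ofBijective (LinearMap.toSpanSingleton Γ(X, U) Γ(M, U) e) (by
    have h := he U le_rfl
    rw [map_self_apply] at h
    exact h)

theorem IsBasisOn.coord_apply {U : X.Opens} {e : Γ(M, U)} (he : IsBasisOn M U e) (r : Γ(X, U)) :
    he.coord r = r • e := rfl

/-- Evaluation of local homomorphisms `M|_U ⟶ N|_U` at a section of `M` over `U`. -/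
def evalAt {U : X.Opens} (e : Γ(M, U)) : homSections M N U →ₗ[Γ(X, U)] Γ(N, U) where
  toFun φ := φ.1 ⟨U, le_rfl⟩ e
  map_add' _ _ := rfl
  map_smul' r φ := by
    rw [homSections_smul_val, LinearMap.smul_apply]
    exact congrArg (· • _) (ConcreteCategory.congr_hom (X.presheaf.map_id _) r)

theorem evalAt_homSectionsRes {U V : X.Opens} (h : V ≤ U) (e : Γ(M, U)) (φ : homSections M N U) :
    evalAt N (M.presheaf.map (homOfLE h).op e) (homSectionsRes h φ) =
      N.presheaf.map (homOfLE h).op (evalAt N e φ) :=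
  (φ.2 ⟨U, le_rfl⟩ ⟨V, h⟩ h e).symm

theorem IsBasisOn.evalAt_injective {U : X.Opens} {e : Γ(M, U)} (he : IsBasisOn M U e) :
    Function.Injective (evalAt N e) := by
  intro φ ψ h
  apply Subtype.ext
  funext V
  ext m
  obtain ⟨r, rfl⟩ := (he V.1 V.2).2 m
  simp only [map_smul]
  rw [← φ.2 ⟨U, le_rfl⟩ V V.2 e, ← ψ.2 ⟨U, le_rfl⟩ V V.2 e]
  exact congrArg (fun n => r • N.presheaf.map (homOfLE V.2).op n) h

theorem IsBasisOn.evalAt_surjective {U : X.Opens} {e : Γ(M, U)} (he : IsBasisOn M U e) :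
    Function.Surjective (evalAt N e) := by
  intro n
  refine ⟨⟨fun V => LinearMap.toSpanSingleton _ _ (N.presheaf.map (homOfLE V.2).op n) ∘ₗ
    (he.restrict V.2).coord.symm.toLinearMap, fun V W h m => ?_⟩, ?_⟩
  · obtain ⟨r, rfl⟩ := (he.restrict V.2).coord.surjective m
    have coord_map : M.presheaf.map (homOfLE h).op ((he.restrict V.2).coord r) =
        (he.restrict W.2).coord (X.presheaf.map (homOfLE h).op r) := by
      rw [coord_apply, coord_apply, map_smul_homOfLE, map_map_apply]
    simp only [LinearMap.comp_apply, LinearEquiv.coe_coe, LinearEquiv.symm_apply_apply,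
      LinearMap.toSpanSingleton_apply, coord_map]
    rw [map_smul_homOfLE, map_map_apply]
  · have coord_one : (he.restrict le_rfl).coord (1 : Γ(X, U)) = e :=
      (one_smul _ _).trans (map_self_apply M e)
    have symm_apply_self : (he.restrict le_rfl).coord.symm e = (1 : Γ(X, U)) :=
      (LinearEquiv.symm_apply_eq _).2 coord_one.symm
    change (he.restrict le_rfl).coord.symm e • N.presheaf.map (homOfLE le_rfl).op n = n
    rw [symm_apply_self, map_self_apply]
    exact one_smul Γ(X, U) n

theorem IsBasisOn.evalAt_bijective {U : X.Opens} {e : Γ(M, U)} (he : IsBasisOn M U e) :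
    Function.Bijective (evalAt N e) :=
  ⟨he.evalAt_injective N, he.evalAt_surjective N⟩

theorem IsFreeOn.dual {U : X.Opens} (hM : IsFreeOn M U) : IsFreeOn (dual M) U := by
  obtain ⟨e, he⟩ := hM
  obtain ⟨φ, hφ⟩ := he.evalAt_surjective (structureModule X) (oneSection U)
  refine ⟨φ, fun V h => ?_⟩
  refine (Function.Bijective.of_comp_iff'
    ((he.restrict h).evalAt_bijective (structureModule X)) _).1 ?_
  have evalAt_smul (r : Γ(X, V)) : evalAt (structureModule X) (M.presheaf.map (homOfLE h).op e)
      (r • homSectionsRes h φ) = r := by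
    rw [map_smul, evalAt_homSectionsRes, hφ, smul_map_oneSection]
  exact (congrArg Function.Bijective (funext evalAt_smul)).mpr Function.bijective_id

theorem ExtendsFromBasicOpens.sheafHom {U : X.Opens} (hM : IsFreeOn M U)
    (hN : ExtendsFromBasicOpens N U) : ExtendsFromBasicOpens (sheafHomObj M N) U := by
  obtain ⟨e, he⟩ := hM
  intro f t
  have hle := X.basicOpen_le f
  obtain ⟨k, n, hn⟩ := hN f (evalAt N (M.presheaf.map (homOfLE hle).op e) t)
  obtain ⟨φ, rfl⟩ := he.evalAt_surjective N n
  refine ⟨k, φ, (he.restrict hle).evalAt_injective N ?_⟩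
  exact (evalAt_homSectionsRes N hle e φ).trans (hn.trans (map_smul (evalAt N _)
    (X.presheaf.map (homOfLE hle).op (f ^ k)) (show homSections M N _ from t)).symm)

end Basis

section TensorBasis
variable {X : Scheme.{u}} {M N : X.Modules} {U : X.Opens}
open TensorProduct

/-- The presheaf `U ↦ M(U) ⊗ N(U)`, whose sheafification is `tensor M N`. -/
abbrev tensorPresheaf (M N : X.Modules) : PresheafOfModules X.ringCatSheaf.obj :=
  PresheafOfModules.Monoidal.tensorObj (R := X.presheaf) M.val N.val

/-- The sheafification map `M(U) ⊗ N(U) → (M ⊗ N)(U)`. -/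
def tensorMk (M N : X.Modules) (U : X.Opens) :
    Γ(M, U) ⊗[Γ(X, U)] Γ(N, U) →ₗ[Γ(X, U)] Γ(tensor M N, U) where
  toFun := ((PresheafOfModules.sheafificationHomEquiv (𝟙 X.ringCatSheaf.obj)
    (𝟙 (tensor M N))).app (op U)).hom
  map_add' := map_add _
  map_smul' := map_smul _

theorem map_tensorMk {V : X.Opens} (h : V ≤ U) (m : Γ(M, U)) (n : Γ(N, U)) :
    (tensor M N).presheaf.map (homOfLE h).op (tensorMk M N U (m ⊗ₜ n)) =
      tensorMk M N V (M.presheaf.map (homOfLE h).op m ⊗ₜ N.presheaf.map (homOfLE h).op n) :=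
  (PresheafOfModules.naturality_apply
    (PresheafOfModules.sheafificationHomEquiv (𝟙 X.ringCatSheaf.obj) (𝟙 (tensor M N)))
    (homOfLE h).op (m ⊗ₜ n)).symm

theorem exists_tensorPresheaf_map_eq_zero {t : Γ(M, U) ⊗[Γ(X, U)] Γ(N, U)}
    (ht : tensorMk M N U t = 0) {x : X} (hx : x ∈ U) :
    ∃ (V : X.Opens) (h : V ≤ U), x ∈ V ∧ (tensorPresheaf M N).map (homOfLE h).op t = 0 := by
  obtain ⟨V, i, hi, hxV⟩ := Presheaf.equalizerSieve_mem (Opens.grothendieckTopology X)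
    (toSheafify (Opens.grothendieckTopology X) (tensorPresheaf M N).presheaf)
    (show (tensorPresheaf M N).presheaf.obj (op U) from t) 0 (ht.trans (map_zero _).symm) x hx
  exact ⟨V, i.le, hxV, hi.trans (map_zero _)⟩

theorem exists_tensorMk_eq_map (t : Γ(tensor M N, U)) {x : X} (hx : x ∈ U) :
    ∃ (V : X.Opens) (h : V ≤ U) (s : Γ(M, V) ⊗[Γ(X, V)] Γ(N, V)), x ∈ V ∧
      tensorMk M N V s = (tensor M N).presheaf.map (homOfLE h).op t := by
  obtain ⟨V, i, ⟨s, hs⟩, hxV⟩ := Presheaf.imageSieve_mem (Opens.grothendieckTopology X)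
    (toSheafify (Opens.grothendieckTopology X) (tensorPresheaf M N).presheaf)
    (show (sheafify _ (tensorPresheaf M N).presheaf).obj (op U) from t) x hx
  exact ⟨V, i.le, s, hxV, hs⟩

theorem bijective_smul_tmul {R M N : Type*} [CommRing R] [AddCommGroup M] [AddCommGroup N]
    [Module R M] [Module R N] {e : M} {e' : N} (he : Function.Bijective fun r : R => r • e)
    (he' : Function.Bijective fun r : R => r • e') :
    Function.Bijective fun r : R => r • (e ⊗ₜ[R] e') := by
  let coord := (TensorProduct.lid R R).symm ≪≫ₗ TensorProduct.congr
    (.ofBijective (LinearMap.toSpanSingleton R M e) he)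
    (.ofBijective (LinearMap.toSpanSingleton R N e') he')
  have coord_apply (r : R) : coord r = r • (e ⊗ₜ[R] e') := by
    change (1 : R) • e ⊗ₜ[R] (r • e') = _
    rw [one_smul, TensorProduct.tmul_smul]
  simpa only [← coord_apply] using coord.bijective

theorem IsBasisOn.tensor {e : Γ(M, U)} {e' : Γ(N, U)} (he : IsBasisOn M U e)
    (he' : IsBasisOn N U e') : IsBasisOn (tensor M N) U (tensorMk M N U (e ⊗ₜ e')) := by
  have smul_tmul {V : X.Opens} (h : V ≤ U) := bijective_smul_tmul (he V h) (he' V h)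
  refine isBasisOn_of_locally (fun V h r hr => ?_) fun V h t x hx => ?_
  · rw [map_tensorMk, ← map_smul] at hr
    refine eq_of_locally_eq (structureModule X) (s := r) (t := (0 : Γ(X, V))) fun x hx => ?_
    obtain ⟨W, hW, hxW, h0⟩ := exists_tensorPresheaf_map_eq_zero hr hx
    refine ⟨W, hW, hxW, Eq.trans ?_ (map_zero _).symm⟩
    refine (smul_tmul (hW.trans h)).1 (Eq.trans ?_ (zero_smul Γ(X, W) _).symm)
    simp only [← map_map_apply _ hW h]
    exact ((tensorPresheaf M N).map_smul (homOfLE hW).op r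
      (M.presheaf.map (homOfLE h).op e ⊗ₜ N.presheaf.map (homOfLE h).op e')).symm.trans h0
  · obtain ⟨W, hW, s, hxW, hs⟩ := exists_tensorMk_eq_map t hx
    obtain ⟨r, rfl⟩ := (smul_tmul (hW.trans h)).2 s
    refine ⟨W, hW, hW.trans h, r, hxW, ?_⟩
    rw [← hs, map_tensorMk, map_smul]

theorem IsFreeOn.tensor (hM : IsFreeOn M U) (hN : IsFreeOn N U) : IsFreeOn (tensor M N) U :=
  hM.elim fun _ he => hN.elim fun _ he' => ⟨_, he.tensor he'⟩

theorem IsFreeOn.tensorPow (hM : IsFreeOn M U) (k : ℕ) : IsFreeOn (tensorPow M k) U := by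
  induction k with
  | zero => exact ⟨_, isBasisOn_oneSection U⟩
  | succ k ih => exact ih.tensor hM

theorem IsFreeOn.tensorZPow (hM : IsFreeOn M U) (b : ℤ) : IsFreeOn (tensorZPow M b) U := by
  cases b with
  | ofNat k => exact hM.tensorPow k
  | negSucc k => exact hM.dual.tensorPow (k + 1)

end TensorBasis

section Pullback
variable {X Y : Scheme.{u}}

instance opensMap_final (f : X ⟶ Y) : (Opens.map f.base).Final where
  out U := isConnected_of_isTerminal _ <| show IsTerminal
      (StructuredArrow.mk (S := U) (T := Opens.map f.base) (Y := ⊤) (homOfLE le_top)) from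
    IsTerminal.ofUniqueHom (fun _ => StructuredArrow.homMk (homOfLE le_top) rfl)
      fun _ _ => by ext; exact Subsingleton.elim _ _

/-- The pullback of the structure sheaf is the structure sheaf. -/
def pullbackStructureModuleIso (f : X ⟶ Y) :
    (Scheme.Modules.pullback f).obj (structureModule Y) ≅ structureModule X :=
  have : (SheafOfModules.pushforward.{u} f.toRingCatSheafHom).IsRightAdjoint :=
    (Scheme.Modules.pullbackPushforwardAdjunction f).isRightAdjoint
  have := opensMap_final f
  @asIso _ _ _ _ (SheafOfModules.pullbackObjUnitToUnit f.toRingCatSheafHom)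
    (SheafOfModules.instIsIsoPullbackObjUnitToUnitOfFinal _)

/-- The morphism `𝒪_U ⟶ M|_U` determined by a section of `M` over `U`. -/
def unitToRestrict {M : X.Modules} {U : X.Opens} (e : Γ(M, U)) :
    structureModule U.toScheme ⟶ M.restrict U.ι :=
  { val := PresheafOfModules.homMk (M₁ := (structureModule U.toScheme).val)
      (M₂ := (M.restrict U.ι).val)
      { app := fun V => AddCommGrpCat.ofHom
          (LinearMap.toAddMonoidHom
            (LinearMap.toSpanSingleton Γ(U.toScheme, V.unop) Γ(M.restrict U.ι, V.unop)
              (show Γ(M.restrict U.ι, V.unop) from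
                M.presheaf.map (homOfLE (Scheme.Opens.ι_image_le U V.unop)).op e)))
        naturality := fun V W i => by
          ext r
          refine Eq.trans ?_ (Scheme.Modules.map_smul (M.restrict U.ι) i.unop r _).symm
          exact congrArg (fun t : Γ(M.restrict U.ι, W.unop) =>
            (show Γ(U.toScheme, W.unop) from U.toScheme.presheaf.map i r) • t)
            (map_map_apply M (Scheme.Hom.image_mono _ i.unop.le)
              (Scheme.Opens.ι_image_le U V.unop) e).symm }
      (by
        intro V r m
        exact mul_smul (show Γ(U.toScheme, V.unop) from r) (show Γ(U.toScheme, V.unop) from m)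
          (show Γ(M.restrict U.ι, V.unop) from
            M.presheaf.map (homOfLE (Scheme.Opens.ι_image_le U V.unop)).op e)) }

theorem IsBasisOn.isIso_unitToRestrict {M : X.Modules} {U : X.Opens} {e : Γ(M, U)}
    (he : IsBasisOn M U e) : IsIso (unitToRestrict e) := by
  rw [Scheme.Modules.Hom.isIso_iff_isIso_app]
  intro V
  rw [ConcreteCategory.isIso_iff_bijective]
  exact (he (U.ι ''ᵁ V) (Scheme.Opens.ι_image_le U V)).comp
    (ConcreteCategory.bijective_of_isIso (U.ι.appIso V).inv)

theorem app_eq_smul_app_oneSection {M : X.Modules} (φ : structureModule X ⟶ M) (W : X.Opens)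
    (r : Γ(X, W)) :
    φ.app W (show Γ(structureModule X, W) from r) =
      r • M.presheaf.map (homOfLE le_top).op (φ.app ⊤ (oneSection ⊤)) := by
  refine Eq.trans ?_ (congrArg (r • ·) (appLinear_res φ le_top (oneSection ⊤))).symm
  exact (congrArg (appLinear φ W) (smul_map_oneSection le_top r)).symm.trans
    (map_smul (appLinear φ W) r _)

theorem isFreeOn_of_iso {M : X.Modules} {U : X.Opens}
    (i : structureModule U.toScheme ≅ M.restrict U.ι) : IsFreeOn M U := by
  suffices H : IsFreeOn M (U.ι ''ᵁ ⊤) by rwa [Scheme.Opens.ι_image_top] at H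
  refine ⟨i.hom.app ⊤ (oneSection ⊤), fun V h => ?_⟩
  rw [Scheme.Opens.ι_image_top] at h
  obtain ⟨W, rfl⟩ : ∃ W : U.toScheme.Opens, V = U.ι ''ᵁ W := by
    refine ⟨U.ι ⁻¹ᵁ V, ?_⟩
    rw [Scheme.Hom.image_preimage_eq_opensRange_inf, Scheme.Opens.opensRange_ι, inf_eq_right.2 h]
  have app_bijective := (ConcreteCategory.bijective_of_isIso (i.hom.app W)).comp
    (ConcreteCategory.bijective_of_isIso (U.ι.appIso W).hom)
  refine (congrArg Function.Bijective (funext fun r => ?_)).mp app_bijective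
  refine (app_eq_smul_app_oneSection i.hom W _).trans ?_
  exact congrArg (fun t : Γ(X, U.ι ''ᵁ W) => t • M.presheaf.map
    (homOfLE (Scheme.Hom.image_mono U.ι (le_top : W ≤ ⊤))).op
      (show Γ(M, U.ι ''ᵁ ⊤) from i.hom.app ⊤ _))
    (ConcreteCategory.congr_hom (U.ι.appIso W).hom_inv_id r)

theorem IsFreeOn.pullback (f : X ⟶ Y) {M : Y.Modules} {U : Y.Opens} (hM : IsFreeOn M U) :
    IsFreeOn ((Scheme.Modules.pullback f).obj M) (f ⁻¹ᵁ U) := by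
  obtain ⟨e, he⟩ := hM
  have := he.isIso_unitToRestrict
  exact isFreeOn_of_iso <| (pullbackStructureModuleIso (f ∣_ U)).symm ≪≫
    (Scheme.Modules.pullback (f ∣_ U)).mapIso (asIso (unitToRestrict e) ≪≫
      (Scheme.Modules.restrictFunctorIsoPullback U.ι).app M) ≪≫
    (Scheme.Modules.pullbackComp _ _).app M ≪≫
    (Scheme.Modules.pullbackCongr (morphismRestrict_ι f U)).app M ≪≫
    (Scheme.Modules.pullbackComp _ _).symm.app M ≪≫
    (Scheme.Modules.restrictFunctorIsoPullback _).symm.app _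

end Pullback

section Exactness
variable {X : Scheme.{u}} {M N : X.Modules}

theorem sheafificationUnit_cokernel_π_eq_zero (g : M ⟶ N) [Epi g] :
    cokernel.π ((SheafOfModules.forget X.ringCatSheaf).map g) ≫
      PresheafOfModules.sheafificationHomEquiv (𝟙 X.ringCatSheaf.obj)
        (𝟙 ((PresheafOfModules.sheafification (𝟙 X.ringCatSheaf.obj)).obj _)) = 0 := by
  let K : X.Modules := (PresheafOfModules.sheafification (𝟙 X.ringCatSheaf.obj)).obj
    (cokernel ((SheafOfModules.forget X.ringCatSheaf).map g))
  let φ : N ⟶ K := ⟨cokernel.π _ ≫ PresheafOfModules.sheafificationHomEquiv _ (𝟙 _)⟩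
  suffices φ = 0 from congrArg (SheafOfModules.forget X.ringCatSheaf).map this
  rw [← cancel_epi g, comp_zero]
  exact (SheafOfModules.forget X.ringCatSheaf).map_injective
    ((cokernel.condition_assoc _ _).trans zero_comp)

theorem exists_app_eq_map_of_epi (g : M ⟶ N) [Epi g] {U : X.Opens} (s : Γ(N, U)) {x : X}
    (hx : x ∈ U) : ∃ (V : X.Opens) (h : V ≤ U) (t : Γ(M, V)), x ∈ V ∧
      g.app V t = N.presheaf.map (homOfLE h).op s := by
  let g' := (SheafOfModules.forget X.ringCatSheaf).map g
  have unit_eq_zero := congrArg (fun φ => φ.app (op U) s) (sheafificationUnit_cokernel_π_eq_zero g)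
  obtain ⟨V, i, hi, hxV⟩ := Presheaf.equalizerSieve_mem (Opens.grothendieckTopology X)
    (toSheafify (Opens.grothendieckTopology X) (cokernel g').presheaf)
    (show (cokernel g').presheaf.obj (op U) from (cokernel.π g').app (op U) s) 0
    (unit_eq_zero.trans (map_zero _).symm) x hx
  obtain ⟨t, ht⟩ := TopCat.Presheaf.sections_exact_of_exact (U := V)
    ((ShortComplex.exact_cokernel g').map (PresheafOfModules.toPresheaf X.ringCatSheaf.obj))
    (s := N.presheaf.map i.op s)
    ((PresheafOfModules.naturality_apply (cokernel.π g') i.op s).trans (hi.trans (map_zero _)))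
  exact ⟨V, i.le, t, hxV, ht⟩

theorem epi_of_exists_app_eq_map (g : M ⟶ N)
    (hg : ∀ (U : X.Opens) (s : Γ(N, U)) (x : X), x ∈ U → ∃ (V : X.Opens) (h : V ≤ U) (t : Γ(M, V)),
      x ∈ V ∧ g.app V t = N.presheaf.map (homOfLE h).op s) : Epi g := by
  refine (SheafOfModules.toSheaf X.ringCatSheaf).epi_of_epi_map
    ((TopCat.Sheaf.isLocallySurjective_iff_epi (X := X.toPresheafedSpace.carrier) _).1
      ((TopCat.Presheaf.isLocallySurjective_iff _).2 fun U s x hx => ?_))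
  obtain ⟨V, h, t, hxV, ht⟩ := hg U s x hx
  exact ⟨V, h, ⟨t, ht⟩, hxV⟩

theorem app_injective_of_mono (f : M ⟶ N) [Mono f] (U : X.Opens) :
    Function.Injective (f.app U) :=
  have : Mono ((Scheme.Modules.toPresheaf X).map f) := inferInstance
  (AddCommGrpCat.mono_iff_injective _).1
    (inferInstanceAs (Mono (((Scheme.Modules.toPresheaf X).map f).app (op U))))

theorem exists_kernel_ι_app_eq (g : M ⟶ N) {U : X.Opens} (s : Γ(M, U))
    (hs : g.app U s = 0) : ∃ t : Γ(kernel g, U), (kernel.ι g).app U t = s := by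
  have : (Scheme.Modules.toPresheaf X).Additive := ⟨rfl⟩
  have left_exact :=
    ((Functor.preservesFiniteLimits_tfae (Scheme.Modules.toPresheaf X)).out 1 3 rfl rfl).mpr
      inferInstance (.mk (kernel.ι g) g (kernel.condition g))
      ⟨ShortComplex.exact_kernel g, inferInstanceAs (Mono (kernel.ι g))⟩
  exact TopCat.Presheaf.sections_exact_of_exact left_exact.1 hs

theorem exact_iff_exists_app_eq_map (S : ShortComplex X.Modules) :
    S.Exact ↔ ∀ (U : X.Opens) (s : Γ(S.X₂, U)), S.g.app U s = 0 → ∀ x ∈ U,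
      ∃ (V : X.Opens) (h : V ≤ U) (t : Γ(S.X₁, V)), x ∈ V ∧
        S.f.app V t = S.X₂.presheaf.map (homOfLE h).op s := by
  have lift_app (V : X.Opens) (t : Γ(S.X₁, V)) :
      (kernel.ι S.g).app V ((kernel.lift S.g S.f S.zero).app V t) = S.f.app V t :=
    congrArg (fun φ : S.X₁ ⟶ S.X₂ => φ.app V t) (kernel.lift_ι S.g S.f S.zero)
  rw [S.exact_iff_epi_kernel_lift]
  constructor
  · intro _ U s hs x hx
    obtain ⟨s, rfl⟩ := exists_kernel_ι_app_eq S.g s hs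
    obtain ⟨V, h, t, hxV, ht⟩ := exists_app_eq_map_of_epi (kernel.lift S.g S.f S.zero) s hx
    refine ⟨V, h, t, hxV, ?_⟩
    rw [← lift_app, ht]
    exact (appLinear_res (kernel.ι S.g) h s).symm
  · intro H
    refine epi_of_exists_app_eq_map _ fun U s x hx => ?_
    obtain ⟨V, h, t, hxV, ht⟩ := H U ((kernel.ι S.g).app U s)
      (congrArg (fun φ : kernel S.g ⟶ S.X₃ => φ.app U s) (kernel.condition S.g)) x hx
    exact ⟨V, h, t, hxV, app_injective_of_mono (kernel.ι S.g) V <|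
      (lift_app V t).trans (ht.trans (appLinear_res (kernel.ι S.g) h s))⟩

theorem IsInvertible.preservesHomology_sheafHom {A : X.Modules} (hA : IsInvertible A) :
    (sheafHom A).PreservesHomology := by
  refine ((Functor.exact_tfae (sheafHom A)).out 1 2 rfl rfl).1 fun S hS => ?_
  rw [exact_iff_exists_app_eq_map] at hS ⊢
  intro U φ hφ x hx
  obtain ⟨W, hxW, hW⟩ := hA x
  obtain ⟨e, he⟩ := hW.mono (inf_le_right : U ⊓ W ≤ W)
  have hle : U ⊓ W ≤ U := inf_le_left
  let ψ : homSections A S.X₂ (U ⊓ W) := homSectionsRes hle (show homSections A S.X₂ U from φ)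
  have app_evalAt_eq_zero : S.g.app (U ⊓ W) (evalAt S.X₂ e ψ) = 0 :=
    congrArg (fun χ : homSections A S.X₃ U => χ.1 ⟨U ⊓ W, hle⟩ e) hφ
  obtain ⟨V, h, t, hxV, ht⟩ := hS _ _ app_evalAt_eq_zero x ⟨hx, hxW⟩
  obtain ⟨τ, rfl⟩ := (he.restrict h).evalAt_surjective S.X₁ t
  exact ⟨V, h.trans hle, τ, hxV, (he.restrict h).evalAt_injective S.X₂ <|
    ht.trans (evalAt_homSectionsRes S.X₂ h e ψ).symm⟩

theorem nonempty_homology_rightDerivedFunctorPlus_iso {C D : Type*} [Category* C] [Category* D]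
    [Abelian C] [Abelian D] [HasDerivedCategory C] [HasDerivedCategory D] [EnoughInjectives C]
    (G : C ⥤ D) [G.Additive] [G.PreservesHomology] (K : DerivedCategory.Plus C) (p : ℤ) :
    Nonempty ((DerivedCategory.Plus.homologyFunctor D p).obj (G.rightDerivedFunctorPlus.obj K) ≅
      G.obj ((DerivedCategory.Plus.homologyFunctor C p).obj K)) := by
  obtain ⟨n, hn⟩ := K.property
  have : K.IsGE n := (DerivedCategory.Plus.isGE_ι_obj_iff K n).1 hn
  obtain ⟨L, -, ⟨e⟩⟩ := DerivedCategory.Plus.exists_injective_nonempty_iso K n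
  let I := (InjectiveObject.ι C).mapCochainComplexPlus.obj L
  have homologyIso : (DerivedCategory.homologyFunctor C p).obj (DerivedCategory.Q.obj I.obj) ≅
      I.obj.homology p := (DerivedCategory.homologyFunctorFactors C p).app I.obj
  have homologyMapIso : (DerivedCategory.homologyFunctor D p).obj
      (DerivedCategory.Q.obj ((G.mapHomologicalComplex _).obj I.obj)) ≅
        G.obj (I.obj.homology p) :=
    (DerivedCategory.homologyFunctorFactors D p).app _ ≪≫ (I.obj.sc p).mapHomologyIso G
  have derivedIso : (DerivedCategory.Plus.homologyFunctor D p).obj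
      (G.rightDerivedFunctorPlus.obj K) ≅ (DerivedCategory.homologyFunctor D p).obj
        (DerivedCategory.Q.obj ((G.mapHomologicalComplex _).obj I.obj)) :=
    (DerivedCategory.Plus.homologyFunctor D p).mapIso
      ((G.rightDerivedFunctorPlus.mapIso e).symm ≪≫
        (asIso (G.rightDerivedFunctorPlusUnit.app
          ((HomotopyCategory.Plus.quotient C).obj I))).symm)
  exact ⟨derivedIso ≪≫ homologyMapIso ≪≫ G.mapIso (homologyIso.symm ≪≫
    (DerivedCategory.Plus.homologyFunctor C p).mapIso e)⟩

end Exactness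

section ExtSheaf
variable {X : Scheme.{u}} {E : X.Modules}

theorem subsingleton_cohomology_of_neg {q : ℤ} (hq : q < 0) : Subsingleton (cohomology q E) := by
  have : ((DerivedCategory.singleFunctor _ 0).obj (abSheaf E)⟦q⟧).IsGE (-q) :=
    DerivedCategory.TStructure.t.isGE_shift _ 0 q (-q) (by lia)
  have eq_zero (x : cohomology q E) : x = 0 :=
    DerivedCategory.TStructure.t.zero x 0 (-q) (by lia)
  exact ⟨fun x y => (eq_zero x).trans (eq_zero y).symm⟩

theorem subsingleton_cohomology_of_isZero (hE : IsZero E) (q : ℤ) :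
    Subsingleton (cohomology q E) :=
  have : IsZero ((DerivedCategory.singleFunctor _ 0).obj (abSheaf E)⟦q⟧) :=
    Functor.map_isZero (shiftFunctor _ q) (Functor.map_isZero _ (Functor.map_isZero _ hE))
  ⟨fun x y => this.eq_of_tgt x y⟩

/-- Isomorphic modules have isomorphic cohomology. -/
def cohomologyEquivOfIso {E' : X.Modules} (i : E ≅ E') (q : ℤ) : cohomology q E ≃ cohomology q E' :=
  Iso.homToEquiv ((shiftFunctor _ q).mapIso ((DerivedCategory.singleFunctor _ 0).mapIso
    ((SheafOfModules.toSheaf X.ringCatSheaf).mapIso i)))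

theorem isQuasicoherent_of_isCoherent (hE : IsCoherent E) : E.IsQuasicoherent := by
  obtain ⟨σ, -⟩ := SheafOfModules.IsFinitePresentation.exists_quasicoherentData (self := hE)
  exact SheafOfModules.QuasicoherentData.isQuasicoherent (R := X.ringCatSheaf) (M := E) σ

theorem IsInvertible.nonempty_extSheaf_iso {A : X.Modules} (hA : IsInvertible A)
    (F : DerivedCategory.Plus X.Modules) (p : ℤ) : Nonempty (extSheaf p A F ≅
      sheafHomObj A ((DerivedCategory.Plus.homologyFunctor X.Modules p).obj F)) :=
  have := hA.preservesHomology_sheafHom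
  nonempty_homology_rightDerivedFunctorPlus_iso (sheafHom A) F p

theorem subsingleton_cohomology_sheafHomObj [X.IsSeparated] {A M : X.Modules} [M.IsQuasicoherent]
    {ι : Type*} [Fintype ι] {U : ι → X.Opens} (hU : ∀ i, IsAffineOpen (U i))
    (hA : ∀ i, IsFreeOn A (U i)) (hcov : ⨆ i, U i = ⊤) {q : ℕ} (hq : Fintype.card ι ≤ q) :
    Subsingleton (cohomology (q : ℤ) (sheafHomObj A M)) := by
  have : HasExt.{u + 1} (Sheaf (Opens.grothendieckTopology X) AddCommGrpCat.{u}) :=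
    hasExt_of_hasDerivedCategory _
  apply subsingleton_cohomology_of_H'
  rw [← hcov, ← Finset.sup_univ_eq_iSup]
  exact subsingleton_H'_sup (P := fun V => IsAffineOpen V ∧ IsFreeOn A V)
    (fun V W hV hW => ⟨hV.1.inf hW.1, hV.2.mono inf_le_left⟩)
    (fun V hV => subsingleton_H'_of_isAffineOpen hV.1 fun W hW hWaff =>
      (extendsFromBasicOpens_of_isQuasicoherent M hWaff).sheafHom M (hV.2.mono hW))
    Finset.univ U (fun i _ => ⟨hU i, hA i⟩) hq

theorem mem_Icc_of_nontrivial_cohomology_extSheaf [X.IsSeparated] {A : X.Modules}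
    {ι : Type*} [Fintype ι] {U : ι → X.Opens} (hU : ∀ i, IsAffineOpen (U i))
    (hA : ∀ i, IsFreeOn A (U i)) (hcov : ⨆ i, U i = ⊤) {F : DerivedCategory.Plus X.Modules}
    {p q : ℤ} [((DerivedCategory.Plus.homologyFunctor X.Modules p).obj F).IsQuasicoherent]
    {r s : ℤ} [F.IsGE r] [F.IsLE s] (h : Nontrivial (cohomology q (extSheaf p A F))) :
    (p, q) ∈ Set.Icc r s ×ˢ Set.Icc 0 ((Fintype.card ι : ℤ) - 1) := by
  have invertible : IsInvertible A := fun x => by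
    obtain ⟨i, hi⟩ := Opens.mem_iSup.1 (hcov ▸ Opens.mem_top x)
    exact ⟨U i, hi, hA i⟩
  obtain ⟨i⟩ := invertible.nonempty_extSheaf_iso F p
  have homology_ne_zero :
      ¬ IsZero ((DerivedCategory.Plus.homologyFunctor X.Modules p).obj F) := fun h0 =>
    not_subsingleton_iff_nontrivial.2 h (subsingleton_cohomology_of_isZero
      (IsZero.of_iso (Functor.map_isZero (sheafHom A) h0) i) q)
  refine ⟨⟨?_, ?_⟩, ?_, ?_⟩ <;> by_contra! hlt
  · exact homology_ne_zero (F.isZero_homology_of_isGE r p hlt)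
  · exact homology_ne_zero (F.isZero_homology_of_isLE s p hlt)
  · exact not_subsingleton_iff_nontrivial.2 h (subsingleton_cohomology_of_neg hlt)
  · obtain ⟨m, rfl⟩ := Int.eq_ofNat_of_zero_le (show 0 ≤ q by dsimp only at hlt; lia)
    have := subsingleton_cohomology_sheafHomObj hU hA hcov (q := m)
      (M := (DerivedCategory.Plus.homologyFunctor X.Modules p).obj F)
      (by dsimp only at hlt; lia)
    exact not_subsingleton_iff_nontrivial.2 h (cohomologyEquivOfIso i m).subsingleton

end ExtSheaf

/-! ### Twisting sheaves of graded algebras -/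

section Twist
variable {A : Type} [CommRing A] [Algebra ℂ A] {𝒜 : ℕ → Submodule ℂ A} [GradedAlgebra 𝒜]

theorem isUnit_algebraMap_locAt_iff {x : ProjectiveSpectrum 𝒜} {b : A} :
    IsUnit (algebraMap A (LocAt 𝒜 x) b) ↔ b ∉ x.asHomogeneousIdeal :=
  IsLocalization.AtPrime.isUnit_to_map_iff _ x.asHomogeneousIdeal.toIdeal b

theorem eq_zero_of_sectionValue_eq_zero {U : (Proj 𝒜).Opens} (r : Γ(Proj 𝒜, U))
    (h : ∀ x : U, sectionValue x r = 0) : r = 0 :=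
  Subtype.ext <| funext fun x => HomogeneousLocalization.val_injective _ <|
    (h x).trans HomogeneousLocalization.val_zero.symm

theorem exists_mul_sectionValue_eq (W : (Proj 𝒜).Opens) {i : ℕ} (a b : 𝒜 i)
    (hb : ∀ y : W, (b : A) ∉ ProjectiveSpectrum.asHomogeneousIdeal (𝒜 := 𝒜) y.1) :
    ∃ r : Γ(Proj 𝒜, W), ∀ y : W, algebraMap A (LocAt 𝒜 y.1) b * sectionValue y r =
      algebraMap A (LocAt 𝒜 y.1) a := by
  let r : (ProjectiveSpectrum.Proj.structureSheaf 𝒜).1.obj (op W) :=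
    ⟨fun y => HomogeneousLocalization.mk ⟨i, a, b, hb y⟩,
      fun y => ⟨W, y.2, 𝟙 _, i, a, b, fun z => hb z, fun z => rfl⟩⟩
  refine ⟨r, fun y => (congrArg _ (HomogeneousLocalization.val_mk _)).trans ?_⟩
  rw [Localization.mk_eq_mk', mul_comm]
  exact IsLocalization.mk'_spec (LocAt 𝒜 y.1) (a : A) ⟨(b : A), hb y⟩

theorem isBasisOn_twist_of_isUnit {k : ℤ} {U : (Proj 𝒜).Opens} (e : twistSections 𝒜 k U)
    (he : ∀ y : U, IsUnit (e.1 y)) : IsBasisOn (twist 𝒜 k) U e := by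
  refine isBasisOn_of_locally (fun V h r hr => ?_) fun V h m x hx => ?_
  · refine eq_zero_of_sectionValue_eq_zero r fun x => ?_
    have value_mul_eq_zero : sectionValue x r * e.1 ⟨x.1, h x.2⟩ = 0 :=
      congrFun (congrArg Subtype.val hr) x
    exact (he ⟨x.1, h x.2⟩).mul_left_eq_zero.1 value_mul_eq_zero
  -- If `m = a / b` and `e = c / d` locally, then `m = r • e` with `r = a d / (b c)`.
  · let m' : twistSections 𝒜 k V := m
    obtain ⟨W, hxW, i, j, a, b, hij, hab⟩ := m'.2 ⟨x, hx⟩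
    obtain ⟨W', hxW', i', j', c, d, hij', hcd⟩ := e.2 ⟨x, h hx⟩
    let O : (Proj 𝒜).Opens := W ⊓ W' ⊓ V
    have hOU : O ≤ U := inf_le_right.trans h
    have m_eq (y : O) := hab ⟨y.1, y.2.2⟩ y.2.1.1
    have e_eq (y : O) := hcd ⟨y.1, hOU y.2⟩ y.2.1.2
    have isUnit_bc (y : O) : IsUnit (algebraMap A (LocAt 𝒜 y.1) (b * c)) := by
      rw [map_mul, ← (e_eq y).2]
      exact (isUnit_algebraMap_locAt_iff.2 (m_eq y).1).mul
        ((isUnit_algebraMap_locAt_iff.2 (e_eq y).1).mul (he ⟨y.1, hOU y.2⟩))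
    obtain ⟨r, hr⟩ := exists_mul_sectionValue_eq O
      ⟨a * d, (show i + j' = j + i' by lia) ▸ SetLike.mul_mem_graded a.2 d.2⟩
      ⟨b * c, SetLike.mul_mem_graded b.2 c.2⟩ fun y => isUnit_algebraMap_locAt_iff.1 (isUnit_bc y)
    refine ⟨O, inf_le_right, hOU, r, ⟨⟨hxW, hxW'⟩, hx⟩, Subtype.ext (funext fun y => ?_)⟩
    change sectionValue y r * e.1 ⟨y.1, hOU y.2⟩ = m'.1 ⟨y.1, y.2.2⟩
    have isUnit_d := isUnit_algebraMap_locAt_iff.2 (e_eq y).1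
    refine ((isUnit_bc y).mul isUnit_d).mul_left_cancel ?_
    have hr := hr y
    simp only [map_mul] at hr ⊢
    linear_combination algebraMap A (LocAt 𝒜 y.1) c * hr +
      algebraMap A (LocAt 𝒜 y.1) b * algebraMap A (LocAt 𝒜 y.1) c * sectionValue y r * (e_eq y).2 -
      algebraMap A (LocAt 𝒜 y.1) c * algebraMap A (LocAt 𝒜 y.1) d * (m_eq y).2

theorem exists_twistSections_isUnit {g : A} (hg : g ∈ 𝒜 1) (k : ℤ) :
    ∃ e : twistSections 𝒜 k (Proj.basicOpen 𝒜 g), ∀ y, IsUnit (e.1 y) := by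
  obtain ⟨p, q, hk⟩ : ∃ p q : ℕ, k = q - p := ⟨(-k).toNat, k.toNat, by lia⟩
  have pow_mem (k : ℕ) : g ^ k ∈ 𝒜 k := by simpa using SetLike.pow_mem_graded k hg
  have isUnit_pow (y : Proj.basicOpen 𝒜 g) (k : ℕ) :
      IsUnit (algebraMap A (LocAt 𝒜 y.1) (g ^ k)) := by
    rw [map_pow]
    exact (isUnit_algebraMap_locAt_iff.2 y.2).pow k
  choose e he using fun y : Proj.basicOpen 𝒜 g => (isUnit_pow y p).dvd
    (a := algebraMap A (LocAt 𝒜 y.1) (g ^ q))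
  refine ⟨⟨e, fun x => ⟨_, x.2, q, p, ⟨_, pow_mem q⟩, ⟨_, pow_mem p⟩, by lia,
    fun y _ => ⟨isUnit_algebraMap_locAt_iff.1 (isUnit_pow y p), (he y).symm⟩⟩⟩, fun y => ?_⟩
  exact isUnit_of_mul_isUnit_right (he y ▸ isUnit_pow y q)

theorem isFreeOn_twist {g : A} (hg : g ∈ 𝒜 1) (k : ℤ) :
    IsFreeOn (twist 𝒜 k) (Proj.basicOpen 𝒜 g) :=
  (exists_twistSections_isUnit hg k).elim fun e he => ⟨e, isBasisOn_twist_of_isUnit e he⟩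

theorem isAffineOpen_projZeroLocusι_preimage_basicOpen {d i : ℕ} (f : 𝒜 d) {g : A} (hg : g ∈ 𝒜 i)
    (hi : 0 < i) : IsAffineOpen (projZeroLocusι 𝒜 f ⁻¹ᵁ Proj.basicOpen 𝒜 g) :=
  Proj.isAffineOpen_basicOpen (quotientGrading 𝒜 (f : A)) _
    (mk_mem_quotientGrading 𝒜 (f : A) hg) hi

theorem isSeparated_projZeroLocus {d : ℕ} (f : 𝒜 d) : (projZeroLocus 𝒜 f).IsSeparated :=
  inferInstanceAs (Proj (quotientGrading 𝒜 (f : A))).IsSeparated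

end Twist

/-! ### Covering a projective scheme by basic open sets -/

section Relations
open MvPolynomial

theorem exists_dvd_aeval_of_trdeg_le {K ι S : Type*} [Field K] [Fintype ι] [CommRing S] [IsDomain S]
    [Algebra K S] (hS : Algebra.trdeg K S ≤ Fintype.card ι) {f : S} (hf : f ≠ 0) (g : ι → S) :
    ∃ R : MvPolynomial ι K, R ≠ 0 ∧ f ∣ aeval g R := by
  by_cases hg : AlgebraicIndependent K g
  · have isAlgebraic_f : IsAlgebraic (Algebra.adjoin K (Set.range g)) f := by
      by_contra transcendental_f
      have card_succ_le := Cardinal.lift_le.2 hS |>.trans' <|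
        AlgebraicIndependent.lift_cardinalMk_le_trdeg <|
          (hg.option_iff_transcendental f).2 transcendental_f
      simp only [Cardinal.mk_fintype, Fintype.card_option, Cardinal.lift_natCast,
        Nat.cast_le] at card_succ_le
      lia
    obtain ⟨⟨r, hr⟩, hr0, f_dvd_r⟩ :=
      isAlgebraic_f.exists_nonzero_dvd (mem_nonZeroDivisors_of_ne_zero hf)
    rw [Algebra.adjoin_range_eq_range_aeval] at hr
    obtain ⟨R, rfl⟩ := hr
    exact ⟨R, fun hR => hr0 (Subtype.ext (hR ▸ map_zero _)), f_dvd_r⟩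
  · simp only [algebraicIndependent_iff, not_forall] at hg
    obtain ⟨R, hRg, hR⟩ := hg
    exact ⟨R, hR, hRg ▸ dvd_zero _⟩

variable {K σ B : Type*} [CommRing B] {d : ℕ}

theorem aeval_mem_of_isHomogeneous [CommSemiring K] [Algebra K B] (ℬ : ℕ → Submodule K B)
    [SetLike.GradedMonoid ℬ] {g : σ → B} (hg : ∀ i, g i ∈ ℬ 1) {R : MvPolynomial σ K}
    (hR : R.IsHomogeneous d) : aeval g R ∈ ℬ d := by
  rw [aeval_def, eval₂_eq]
  refine sum_mem fun m hm => ?_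
  rw [← Algebra.smul_def]
  have degree_eq : ∑ i ∈ m.support, m i • 1 = d := by
    simpa using (hR.degree_eq_sum_deg_support hm).symm
  exact Submodule.smul_mem _ _ <|
    degree_eq ▸ SetLike.prod_pow_mem_graded ℬ (fun _ => 1) g m fun i _ => hg i

theorem aeval_smul_of_isHomogeneous [CommSemiring K] [Algebra K B] {R : MvPolynomial σ K}
    (hR : R.IsHomogeneous d) (c : σ → K) (γ : B) :
    aeval (fun i => c i • γ) R = eval c R • γ ^ d := by
  rw [aeval_def, eval₂_eq, eval_eq, Finset.sum_smul]
  refine Finset.sum_congr rfl fun m hm => ?_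
  simp only [smul_pow, Finset.prod_smul, Finset.prod_pow_eq_pow_sum, mul_smul,
    ← hR.degree_eq_sum_deg_support hm, Algebra.smul_def (coeff m R)]

theorem exists_isHomogeneous_aeval_eq_zero [CommRing K] [Algebra K B] (ℬ : ℕ → Submodule K B)
    [GradedAlgebra ℬ] {g : σ → B} (hg : ∀ i, g i ∈ ℬ 1) {R : MvPolynomial σ K} (hR : R ≠ 0)
    (h : aeval g R = 0) :
    ∃ (d : ℕ) (Q : MvPolynomial σ K), Q ≠ 0 ∧ Q.IsHomogeneous d ∧ aeval g Q = 0 := by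
  obtain ⟨d, hd⟩ : ∃ d, homogeneousComponent d R ≠ 0 := by
    by_contra! h0
    exact hR (by rw [← sum_homogeneousComponent R, Finset.sum_eq_zero fun i _ => h0 i])
  have aeval_mem (i : ℕ) : aeval g (homogeneousComponent i R) ∈ ℬ i :=
    aeval_mem_of_isHomogeneous ℬ hg (homogeneousComponent_isHomogeneous i R)
  refine ⟨d, _, hd, homogeneousComponent_isHomogeneous d R, ?_⟩
  have proj_aeval : GradedRing.proj ℬ d (aeval g R) = aeval g (homogeneousComponent d R) := by
    conv_lhs => rw [← sum_homogeneousComponent R]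
    rw [map_sum, map_sum, Finset.sum_eq_single d]
    · rw [GradedRing.proj_apply, DirectSum.decompose_of_mem_same _ (aeval_mem d)]
    · intro i _ hi
      rw [GradedRing.proj_apply, DirectSum.decompose_of_mem_ne _ (aeval_mem i) hi]
    · intro hd'
      rw [homogeneousComponent_eq_zero _ _ (by simpa using hd'), map_zero, map_zero]
  rw [← proj_aeval, h, map_zero]

theorem mem_of_eval_ne_zero [Field K] [Algebra K B] {R : MvPolynomial σ K}
    (hR : R.IsHomogeneous d) {c : σ → K} (hc : eval c R ≠ 0) {g : σ → B} (h : aeval g R = 0)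
    {𝔭 : Ideal B} (h𝔭 : 𝔭.IsPrime) {γ : B} (hg : ∀ i, g i - c i • γ ∈ 𝔭) : γ ∈ 𝔭 := by
  have g_eq : (fun i => Ideal.Quotient.mkₐ K 𝔭 (g i)) =
      fun i => c i • Ideal.Quotient.mkₐ K 𝔭 γ :=
    funext fun i => (Ideal.Quotient.eq.2 (hg i)).trans (map_smul (Ideal.Quotient.mkₐ K 𝔭) _ _)
  have eval_smul_pow : eval c R • Ideal.Quotient.mkₐ K 𝔭 γ ^ d = 0 := by
    rw [← aeval_smul_of_isHomogeneous hR, ← g_eq, ← map_zero (Ideal.Quotient.mkₐ K 𝔭), ← h,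
      ← AlgHom.comp_apply, comp_aeval]
  rw [smul_eq_zero_iff_right hc, ← map_pow] at eval_smul_pow
  exact h𝔭.mem_of_pow_mem d (Ideal.Quotient.eq_zero_iff_mem.1 eval_smul_pow)

-- Linear projection from a point `c` with `R(c) ≠ 0` has no base points on the zeros of `R`.
theorem exists_forall_mem_of_isHomogeneous [Field K] [Infinite K] [Algebra K B] {N : ℕ}
    {g : Fin (N + 1) → B} {R : MvPolynomial (Fin (N + 1)) K} (hR0 : R ≠ 0)
    (hR : R.IsHomogeneous d) (h : aeval g R = 0) :
    ∃ t : Fin N → K, ∀ 𝔭 : Ideal B, 𝔭.IsPrime → (∀ i, g i.succ - t i • g 0 ∈ 𝔭) →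
      ∀ i, g i ∈ 𝔭 := by
  obtain ⟨c, hc⟩ : ∃ c : Fin (N + 1) → K, eval c (R * X 0) ≠ 0 := by
    by_contra! h0
    exact mul_ne_zero hR0 (X_ne_zero 0) (MvPolynomial.funext fun c => by rw [h0, map_zero])
  rw [map_mul, eval_X] at hc
  obtain ⟨eval_ne_zero, c_zero_ne_zero⟩ := mul_ne_zero_iff.1 hc
  refine ⟨fun i => c i.succ / c 0, fun 𝔭 h𝔭 hmem => ?_⟩
  have sub_mem (i : Fin (N + 1)) : g i - c i • (c 0)⁻¹ • g 0 ∈ 𝔭 := by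
    refine Fin.cases ?_ (fun i => ?_) i
    · rw [smul_inv_smul₀ c_zero_ne_zero, sub_self]
      exact 𝔭.zero_mem
    · rw [smul_smul, ← div_eq_mul_inv]
      exact hmem i
  have smul_g_zero_mem := mem_of_eval_ne_zero hR eval_ne_zero h h𝔭 sub_mem
  intro i
  rw [← sub_add_cancel (g i) (c i • (c 0)⁻¹ • g 0)]
  exact 𝔭.add_mem (sub_mem i) (Submodule.smul_of_tower_mem 𝔭 _ smul_g_zero_mem)

end Relations

section Cover
variable {A : Type} [CommRing A] [Algebra ℂ A] {𝒜 : ℕ → Submodule ℂ A} [GradedAlgebra 𝒜]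

theorem iSup_proj_basicOpen_eq_top_iff {ι : Type*} {g : ι → A} :
    ⨆ i, Proj.basicOpen 𝒜 (g i) = ⊤ ↔
      ∀ x : ProjectiveSpectrum 𝒜, ∃ i, g i ∉ x.asHomogeneousIdeal := by
  simp only [eq_top_iff, SetLike.le_def, Opens.mem_iSup]
  exact ⟨fun h x => h (Opens.mem_top _), fun h x _ => h x⟩

variable {d : ℕ} {f : 𝒜 d}

theorem iSup_preimage_basicOpen_eq_top_iff {ι : Type*} {g : ι → A} :
    ⨆ i, projZeroLocusι 𝒜 f ⁻¹ᵁ Proj.basicOpen 𝒜 (g i) = ⊤ ↔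
      ∀ x : ProjectiveSpectrum (quotientGrading 𝒜 (f : A)), ∃ i,
        Ideal.Quotient.mkₐ ℂ (Ideal.span {(f : A)}) (g i) ∉ x.asHomogeneousIdeal :=
  iSup_proj_basicOpen_eq_top_iff

theorem exists_iSup_preimage_basicOpen_eq_top_of_succ [IsDomain A] (hf : f ≠ 0) {N : ℕ}
    (hN : Algebra.trdeg ℂ A ≤ (N + 1 : ℕ)) {g : Fin (N + 1) → 𝒜 1}
    (hg : ⨆ i, projZeroLocusι 𝒜 f ⁻¹ᵁ Proj.basicOpen 𝒜 (g i) = ⊤) :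
    ∃ g' : Fin N → 𝒜 1, ⨆ i, projZeroLocusι 𝒜 f ⁻¹ᵁ Proj.basicOpen 𝒜 (g' i) = ⊤ := by
  let π := Ideal.Quotient.mkₐ ℂ (Ideal.span {(f : A)})
  obtain ⟨R, hR, f_dvd⟩ := exists_dvd_aeval_of_trdeg_le (hN.trans_eq (by rw [Fintype.card_fin]))
    (show (f : A) ≠ 0 by simpa using hf) fun i => (g i : A)
  have aeval_eq_zero : MvPolynomial.aeval (fun i => π (g i)) R = 0 := by
    rw [← Ideal.mem_span_singleton, ← Ideal.Quotient.eq_zero_iff_mem] at f_dvd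
    rw [← f_dvd, ← Ideal.Quotient.mkₐ_eq_mk ℂ, ← AlgHom.comp_apply, MvPolynomial.comp_aeval]
  obtain ⟨d, Q, hQ0, hQ, hQg⟩ := exists_isHomogeneous_aeval_eq_zero (quotientGrading 𝒜 (f : A))
    (fun i => mk_mem_quotientGrading 𝒜 (f : A) (g i).2) hR aeval_eq_zero
  obtain ⟨t, ht⟩ := exists_forall_mem_of_isHomogeneous hQ0 hQ hQg
  refine ⟨fun i => g i.succ - t i • g 0, iSup_preimage_basicOpen_eq_top_iff.2 fun x => ?_⟩
  by_contra! h
  obtain ⟨i, hi⟩ := iSup_preimage_basicOpen_eq_top_iff.1 hg x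
  exact hi (ht _ x.isPrime h i)

theorem exists_iSup_preimage_basicOpen_eq_top_of_trdeg_le [IsDomain A] (hf : f ≠ 0) {n M : ℕ}
    (hn : Algebra.trdeg ℂ A ≤ (n + 1 : ℕ)) {g : Fin M → 𝒜 1}
    (hg : ⨆ i, Proj.basicOpen 𝒜 (g i : A) = ⊤) :
    ∃ N ≤ n, ∃ g : Fin N → 𝒜 1, ⨆ i, projZeroLocusι 𝒜 f ⁻¹ᵁ Proj.basicOpen 𝒜 (g i) = ⊤ := by
  have hg' : ⨆ i, projZeroLocusι 𝒜 f ⁻¹ᵁ Proj.basicOpen 𝒜 (g i) = ⊤ := by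
    rw [← Scheme.Hom.preimage_iSup, hg, Scheme.Hom.preimage_top]
  obtain hMn | hnM := le_total M n
  · exact ⟨M, hMn, g, hg'⟩
  refine ⟨n, le_rfl, Nat.decreasingInduction' (P := fun N => ∃ g : Fin N → 𝒜 1,
    ⨆ i, projZeroLocusι 𝒜 f ⁻¹ᵁ Proj.basicOpen 𝒜 (g i) = ⊤) (fun N _ hN ⟨g, hg⟩ => ?_) hnM ⟨g, hg'⟩⟩
  exact exists_iSup_preimage_basicOpen_eq_top_of_succ hf
    (hn.trans (Nat.cast_le.2 (Nat.succ_le_succ hN))) hg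

end Cover

section TrdegMonoidAlgebra
open AddMonoidAlgebra

variable {K M : Type*} [CommRing K] [AddCommMonoid M]

theorem single_mem_adjoin_of_mem_closure {s : Set M} {a : M} (ha : a ∈ AddSubmonoid.closure s) :
    single a 1 ∈ Algebra.adjoin K ((fun m => (single m 1 : AddMonoidAlgebra K M)) '' s) := by
  induction ha using AddSubmonoid.closure_induction with
  | mem a ha => exact Algebra.subset_adjoin ⟨a, ha, rfl⟩
  | zero => exact one_mem _
  | add a b _ _ ha hb => simpa only [single_mul_single, one_mul] using mul_mem ha hb

theorem isAlgebraic_adjoin_single [IsDomain (AddMonoidAlgebra K M)] {s : Set M}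
    (hs : ∀ m, ∃ a ∈ AddSubmonoid.closure s, m + a ∈ AddSubmonoid.closure s) :
    Algebra.IsAlgebraic (Algebra.adjoin K ((fun m => single m (1 : K)) '' s))
      (AddMonoidAlgebra K M) := by
  let S := Algebra.adjoin K ((fun m => (single m 1 : AddMonoidAlgebra K M)) '' s)
  have isAlgebraic_of_mem_closure {a : M} (ha : a ∈ AddSubmonoid.closure s) :
      IsAlgebraic S (single a 1 : AddMonoidAlgebra K M) :=
    isAlgebraic_algebraMap (⟨_, single_mem_adjoin_of_mem_closure ha⟩ : S)
  have isAlgebraic_single (m : M) : IsAlgebraic S (single m 1 : AddMonoidAlgebra K M) := by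
    obtain ⟨a, ha, hma⟩ := hs m
    have single_ne_zero : (single a 1 : AddMonoidAlgebra K M) ≠ 0 := by
      have := (algebraMap K (AddMonoidAlgebra K M)).domain_nontrivial
      exact single_ne_zero.2 one_ne_zero
    refine IsAlgebraic.of_mul (mem_nonZeroDivisors_of_ne_zero single_ne_zero)
      (isAlgebraic_of_mem_closure ha) ?_
    rw [single_mul_single, one_mul, add_comm]
    exact isAlgebraic_of_mem_closure hma
  refine ⟨fun a => ?_⟩
  induction a using AddMonoidAlgebra.induction_linear with
  | zero => exact isAlgebraic_zero
  | add a b ha hb => exact ha.add hb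
  | single m r =>
    have single_eq : (single m r : AddMonoidAlgebra K M) = algebraMap K S r • single m 1 := by
      rw [algebraMap_smul, smul_single, smul_eq_mul, mul_one]
    exact single_eq ▸ (isAlgebraic_single m).smul _

theorem trdeg_addMonoidAlgebra_le [IsDomain (AddMonoidAlgebra K M)] {ι : Type*} [Fintype ι]
    {x : ι → M} (hx : ∀ m, ∃ a ∈ AddSubmonoid.closure (Set.range x),
      m + a ∈ AddSubmonoid.closure (Set.range x)) :
    Algebra.trdeg K (AddMonoidAlgebra K M) ≤ Fintype.card ι := by
  have := isAlgebraic_adjoin_single (K := K) hx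
  refine (Algebra.IsAlgebraic.trdeg_le_cardinalMk K
    ((fun m => single m (1 : K)) '' Set.range x)).trans ?_
  rw [← Set.range_comp]
  simpa using Cardinal.mk_range_le_lift (f := (fun m => single m (1 : K)) ∘ x)

theorem trdeg_addMonoidAlgebra_int_nat_le [IsDomain K] (n : ℕ) :
    Algebra.trdeg K (AddMonoidAlgebra K ((Fin n → ℤ) × ℕ)) ≤ (n + 1 : ℕ) := by
  let x : Option (Fin n) → (Fin n → ℤ) × ℕ := fun o => o.elim (0, 1) fun i => (Pi.single i 1, 0)
  have mem_closure (w : Fin n → ℕ) (k : ℕ) :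
      (fun i => (w i : ℤ), k) ∈ AddSubmonoid.closure (Set.range x) := by
    have eq_sum : ((fun i => (w i : ℤ), k) : (Fin n → ℤ) × ℕ) =
        ∑ i, w i • x (some i) + k • x none := by
      ext <;> simp [x, Prod.fst_sum, Prod.snd_sum, Finset.sum_apply, Pi.single_apply]
    rw [eq_sum]
    have mem_closure_range (o : Option (Fin n)) : x o ∈ AddSubmonoid.closure (Set.range x) :=
      AddSubmonoid.subset_closure (Set.mem_range_self o)
    exact add_mem (sum_mem fun i _ => nsmul_mem (mem_closure_range _) _)
      (nsmul_mem (mem_closure_range _) _)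
  refine (trdeg_addMonoidAlgebra_le (x := x) fun ⟨v, k⟩ =>
    ⟨_, mem_closure (fun i => (-v i).toNat) 0, ?_⟩).trans_eq (by simp)
  convert mem_closure (fun i => (v i).toNat) k using 1
  ext i <;> simp only [Prod.mk_add_mk, Pi.add_apply, add_zero]
  lia

end TrdegMonoidAlgebra

/-! ### The cone over a lattice polytope -/

section ConvexHull
open Pointwise
variable {E : Type*} [AddCommGroup E] [Module ℝ E] {t : Finset E} {y : E} {r : ℝ}

theorem exists_sum_smul_eq_of_mem_smul_convexHull (hr : 0 ≤ r)
    (hy : y ∈ r • convexHull ℝ (t : Set E)) :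
    ∃ w : E → ℝ, (∀ v ∈ t, 0 ≤ w v) ∧ ∑ v ∈ t, w v = r ∧ ∑ v ∈ t, w v • v = y := by
  obtain ⟨z, hz, rfl⟩ := hy
  obtain ⟨w, w_nonneg, sum_w, sum_w_smul⟩ := Finset.mem_convexHull'.1 hz
  refine ⟨fun v => r * w v, fun v hv => mul_nonneg hr (w_nonneg v hv), ?_, ?_⟩
  · rw [← Finset.mul_sum, sum_w, mul_one]
  · simp only [mul_smul, ← Finset.smul_sum, sum_w_smul]

theorem sum_smul_mem_smul_convexHull {w : E → ℝ} (w_nonneg : ∀ v ∈ t, 0 ≤ w v)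
    (sum_pos : 0 < ∑ v ∈ t, w v) : ∑ v ∈ t, w v • v ∈ (∑ v ∈ t, w v) • convexHull ℝ (t : Set E) :=
  ⟨t.centerMass w id, t.centerMass_mem_convexHull w_nonneg sum_pos fun _ hv => hv,
    smul_inv_smul₀ sum_pos.ne' _⟩

theorem exists_nsmul_sub_mem_smul_convexHull (hr : 0 < r)
    (hy : y ∈ r • convexHull ℝ (t : Set E)) :
    ∃ v ∈ t, ∃ N : ℕ, 1 < N * r ∧ N • y - v ∈ (N * r - 1) • convexHull ℝ (t : Set E) := by
  classical
  obtain ⟨w, w_nonneg, rfl, rfl⟩ := exists_sum_smul_eq_of_mem_smul_convexHull hr.le hy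
  obtain ⟨v, hv, w_pos⟩ : ∃ v ∈ t, 0 < w v := Finset.exists_lt_of_sum_lt (by simpa using hr)
  obtain ⟨N, hN⟩ := exists_nat_gt (1 / w v)
  rw [div_lt_iff₀ w_pos] at hN
  have one_lt : 1 < N * ∑ u ∈ t, w u := hN.trans_le <|
    mul_le_mul_of_nonneg_left (Finset.single_le_sum w_nonneg hv) N.cast_nonneg
  have sum_sub : ∑ u ∈ t, (N * w u - if u = v then 1 else 0) = N * ∑ u ∈ t, w u - 1 := by
    rw [Finset.sum_sub_distrib, ← Finset.mul_sum, Finset.sum_ite_eq', if_pos hv]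
  have sum_sub_smul : ∑ u ∈ t, (N * w u - if u = v then 1 else 0) • u =
      N • ∑ u ∈ t, w u • u - v := by
    simp only [sub_smul, mul_smul, ite_smul, one_smul, zero_smul]
    rw [Finset.sum_sub_distrib, ← Finset.smul_sum, Finset.sum_ite_eq', if_pos hv,
      Nat.cast_smul_eq_nsmul]
  refine ⟨v, hv, N, one_lt, ?_⟩
  rw [← sum_sub, ← sum_sub_smul]
  refine sum_smul_mem_smul_convexHull (fun u hu => ?_) (sum_sub ▸ sub_pos.2 one_lt)
  split_ifs with h
  · exact h ▸ sub_nonneg.2 hN.le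
  · simpa using mul_nonneg N.cast_nonneg (w_nonneg u hu)

end ConvexHull

namespace LatticePolytope
open AddMonoidAlgebra Pointwise
variable {n : ℕ} (Δ : LatticePolytope n)

instance twoUniqueSums_coneMonoid : TwoUniqueSums Δ.coneMonoid :=
  TwoUniqueSums.of_injective_addHom Δ.coneMonoid.subtype.toAddHom Subtype.val_injective
    inferInstance

theorem trdeg_polytopeAlgebra_le : Algebra.trdeg ℂ Δ.polytopeAlgebra ≤ (n + 1 : ℕ) :=
  (trdeg_le_of_injective (mapDomainAlgHom ℂ ℂ Δ.coneMonoid.subtype)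
    (mapDomain_injective Subtype.val_injective)).trans (trdeg_addMonoidAlgebra_int_nat_le n)

theorem mem_coneMonoid_of_mem_points {v : Fin n → ℤ} (hv : v ∈ Δ.points) :
    (v, 1) ∈ Δ.coneMonoid := by
  change toReal v ∈ ((1 : ℕ) : ℝ) • Δ.carrier
  rw [Nat.cast_one, one_smul]
  exact subset_convexHull ℝ _ ⟨v, hv, rfl⟩

theorem exists_nsmul_eq_add (x : Δ.coneMonoid) (hx : 0 < Δ.degree x) :
    ∃ (v : Δ.points) (N : ℕ) (y : Δ.coneMonoid),
      N • x = ⟨(v.1, 1), Δ.mem_coneMonoid_of_mem_points v.2⟩ + y := by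
  classical
  obtain ⟨⟨m, k⟩, hm⟩ := x
  have carrier_eq : Δ.carrier = convexHull ℝ ((Δ.points.image toReal : Finset _) : Set _) := by
    rw [carrier, Finset.coe_image]
  have toReal_mem : toReal m ∈ (k : ℝ) • Δ.carrier := hm
  rw [carrier_eq] at toReal_mem
  obtain ⟨_, mem_image, N, one_lt, sub_mem⟩ :=
    exists_nsmul_sub_mem_smul_convexHull (Nat.cast_pos.2 hx) toReal_mem
  obtain ⟨v, hv, rfl⟩ := Finset.mem_image.1 mem_image
  have one_le : 1 ≤ N * k := by exact_mod_cast one_lt.le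
  have mem_coneMonoid : (N • m - v, N * k - 1) ∈ Δ.coneMonoid := by
    change toReal (N • m - v) ∈ ((N * k - 1 : ℕ) : ℝ) • Δ.carrier
    have toReal_sub : toReal (N • m - v) = N • toReal m - toReal v := by
      ext i
      simp [toReal]
    rw [toReal_sub, Nat.cast_sub one_le, Nat.cast_mul, Nat.cast_one, carrier_eq]
    exact sub_mem
  refine ⟨⟨v, hv⟩, N, ⟨_, mem_coneMonoid⟩, Subtype.ext (Prod.ext ?_ ?_)⟩
  · exact (add_sub_cancel v (N • m)).symm
  · exact (Nat.add_sub_cancel' one_le).symm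

/-- The monomial `χ^v t` of a lattice point `v` that spans `Δ`, as a section of `𝒪_X(D_Δ)`. -/
def pointMonomial (v : Δ.points) : Δ.grading 1 :=
  ⟨single ⟨(v.1, 1), Δ.mem_coneMonoid_of_mem_points v.2⟩ 1, single_mem_gradeBy Δ.degree _ 1⟩

theorem mem_of_forall_pointMonomial_mem {𝔭 : Ideal Δ.polytopeAlgebra} (h𝔭 : 𝔭.IsPrime)
    (h : ∀ v, (Δ.pointMonomial v : Δ.polytopeAlgebra) ∈ 𝔭) {k : ℕ} (hk : 0 < k)
    {a : Δ.polytopeAlgebra} (ha : a ∈ Δ.grading k) : a ∈ 𝔭 := by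
  have single_one_mem (x : Δ.coneMonoid) (hx : 0 < Δ.degree x) : single x 1 ∈ 𝔭 := by
    obtain ⟨v, N, y, hy⟩ := Δ.exists_nsmul_eq_add x hx
    refine h𝔭.mem_of_pow_mem N ?_
    rw [single_pow, one_pow, hy, ← one_mul (1 : ℂ), ← single_mul_single]
    exact 𝔭.mul_mem_right _ (h v)
  rw [← sum_coeff_single a]
  refine sum_mem fun x hx => ?_
  have single_eq : single x (a.coeff x) = single 0 (a.coeff x) * single x (1 : ℂ) := by
    rw [single_mul_single, zero_add, mul_one]
  rw [single_eq]
  exact 𝔭.mul_mem_left _ (single_one_mem x (ha x hx ▸ hk))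

theorem iSup_basicOpen_pointMonomial :
    ⨆ v, Proj.basicOpen Δ.grading (Δ.pointMonomial v : Δ.polytopeAlgebra) = ⊤ := by
  refine iSup_proj_basicOpen_eq_top_iff.2 fun x => ?_
  by_contra! h
  exact x.not_irrelevant_le <| (HomogeneousIdeal.irrelevant_le _).2 fun i hi a ha =>
    Δ.mem_of_forall_pointMonomial_mem x.isPrime h hi ha

theorem exists_iSup_preimage_basicOpen_eq_top {d : ℕ} {f : Δ.grading d} (hf : f ≠ 0) :
    ∃ N ≤ n, ∃ g : Fin N → Δ.grading 1, ⨆ i, projZeroLocusι Δ.grading f ⁻¹ᵁ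
      Proj.basicOpen Δ.grading (g i : Δ.polytopeAlgebra) = ⊤ := by
  refine exists_iSup_preimage_basicOpen_eq_top_of_trdeg_le hf Δ.trdeg_polytopeAlgebra_le
    (g := Δ.pointMonomial ∘ Δ.points.equivFin.symm) ?_
  rw [← Δ.iSup_basicOpen_pointMonomial]
  exact Δ.points.equivFin.symm.iSup_comp (g := fun v =>
    Proj.basicOpen Δ.grading (Δ.pointMonomial v : Δ.polytopeAlgebra))

end LatticePolytope

end

end BraneVertex

theorem theorem4p2_general {n d : ℕ} (Δ : BraneVertex.LatticePolytope n) {f : Δ.grading d}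
    (hf : f ≠ 0) (k b : ℤ) {r s p q : ℤ}
    (F : DerivedCategory.Plus (BraneVertex.projZeroLocus Δ.grading f).Modules)
    (hr : F.IsGE r) (hs : F.IsLE s)
    (hF : ((DerivedCategory.Plus.homologyFunctor _ p).obj F).IsQuasicoherent)
    (h : Nontrivial (BraneVertex.cohomology q (BraneVertex.extSheaf p (BraneVertex.tensorZPow
      ((Scheme.Modules.pullback (BraneVertex.projZeroLocusι Δ.grading f)).obj
        (BraneVertex.twist Δ.grading k)) b) F))) :
    (p, q) ∈ Set.Icc r s ×ˢ Set.Icc 0 ((n : ℤ) - 1) := by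
  obtain ⟨N, hN, g, hcov⟩ := Δ.exists_iSup_preimage_basicOpen_eq_top hf
  have := BraneVertex.isSeparated_projZeroLocus f
  have mem_Icc := BraneVertex.mem_Icc_of_nontrivial_cohomology_extSheaf (r := r) (s := s)
    (fun i => BraneVertex.isAffineOpen_projZeroLocusι_preimage_basicOpen f (g i).2 one_pos)
    (fun i => ((BraneVertex.isFreeOn_twist (g i).2 k).pullback _).tensorZPow b) hcov h
  rw [Fintype.card_fin] at mem_Icc
  exact ⟨mem_Icc.1, mem_Icc.2.1, mem_Icc.2.2.trans (by lia)⟩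

theorem theorem4p2 {n : ℕ} (Δ : BraneVertex.LatticePolytope n) (hΔ : Δ.IsReflexive)
    (f : Δ.grading 1) (hf : f ≠ 0) (r s : ℤ) (F : BraneVertex.Db (Δ.hypersurface f))
    (hs : F.obj.IsLE s) (hr : F.obj.IsGE r) (b p q : ℤ)
    (h : Nontrivial (BraneVertex.cohomology q
      (BraneVertex.extSheaf p (BraneVertex.tensorZPow (Δ.lineBundle f) b) F.obj))) :
    (p, q) ∈ Set.Icc r s ×ˢ Set.Icc 0 ((n : ℤ) - 1) :=
  theorem4p2_general Δ hf ((n : ℤ) - 1) b F.obj hr hs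
    (BraneVertex.isQuasicoherent_of_isCoherent (F.property.2 p)) h
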